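/- Let $d,K\ge 1$, $L,T>0$, $\mathbb T^d=(\mathbb R/L\mathbb Z)^d$, and let $\beta=(\beta_1,\dots,\beta_K)$ be a standard $K$-dimensional Brownian motion on a probability space; let $\mathscr F_{r,t}$ be generated by the increments of $\beta$ in $[r,t]$. Let $E:[0,T]\times\mathbb T^d\to\mathbb R^d$ and $\sigma_1,\dots,\sigma_K:\mathbb T^d\to\mathbb R^d$ be Lipschitz continuous, let $\phi_{0,t}$ be the stochastic flow of homeomorphisms of $\mathbb T^d\times\mathbb R^d$ generated by $$\mathrm dX=V\,\mathrm dt,\qquad \mathrm dV=E(t,X)\,\mathrm dt+\sum_{k=1}^K\sigma_k(X)\,\mathrm d\beta_k ,$$ and $\widehat\phi_{0,t}=\phi_{0,t}^{-1}$. Let $f_0:\mathbb T^d\times\mathbb R^d\to[0,\infty)$ be Lipschitz and twice continuously differentiable with bounded second derivatives, with $\|f_0\|_{L^1}=1$ and $\sup_x|f_0(x,v)|\to0$ as $\|v\|\to\infty$. Let $f(t,x,v)=f_0(\widehat\phi_{0,t}(x,v))$ be the solution of the stochastic linear Vlasov equation with field $E$ and transport noise $\sigma$. *Numerical flow.* For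 $N\ge1$ let $\tau=T/N$, $t_n=n\tau$. Let $\Psi_{t_{n-1},t_n}$ ($1\le n\le N$) be random $C^2$ diffeomorphisms of $\mathbb T^d\times\mathbb R^d$ with $\det\nabla\Psi_{t_{n-1},t_n}=1$, whose inverses $\widehat\Psi_{t_{n-1},t_n}$ are $C^2$, are $\mathscr F_{t_{n-1},t_n}$-measurable at each point, and have velocity component satisfying $$|\widehat\Psi^2_{t_{n-1},t_n}(x,v)-v|_{\ell^\infty}\le\widetilde\Xi_n:=\tau\|E\|_{L^\infty(\ell^\infty)}+\sum_k\|\sigma_k\|_{L^\infty(\ell^\infty)}|\beta_k(t_n)-\beta_k(t_{n-1})|.$$ Let $\Psi_{0,t_n}$ be the composition of the first $n$ steps and $\widehat\Psi_{0,t_n}$ its inverse. Assume, for given constants $A(p)$, $B$, $Q>0$, $\gamma\ge1$, $p_0\ge1$ not depending on $N$, that for all $(x,v)$ and $0\le n\le N$: 1. $\mathbb E\|D^j\Psi_{0,t_n}(x,v)\|^p+\mathbb E\|D^j\widehat\Psi_{0,t_n}(x,v)\|^p\le A(p)$ for $j=1,2$ and all $p\ge2$; 2. $\big(\mathbb E\|\widehat\Psi_{0,t_n}(x,v)-\widehat\phi_{0,t_n}(x,v)\|^{2p_0}\big)^{1/(2p_0)}\le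 B\,\tau^Q(1+\|x\|^{2\gamma}+\|v\|^{2\gamma})^{1/2}$. *Scheme.* Let $\delta y=(\delta x_1,\dots,\delta x_d,\delta v_1,\dots,\delta v_d)$ be positive stepsizes, $h=|\delta y|_{\ell^\infty}$, and let $\mathscr R$ be the (piecewise multilinear) Lagrange first-order interpolation from the grid $\{(j_i\delta x_i,k_i\delta v_i)\}$ on $\mathbb T^d\times\mathbb R^d$. Let $\epsilon_0>0$, let $U_0>0$ be such that $|f_0(x,v)|<\epsilon_0$ whenever $v\notin[-U_0,U_0]^d$, and let $\Xi_n\ge\widetilde\Xi_n$ be random variables; assume that $L/\delta x_i$, $U_0/\delta v_i$ and $\Xi_n/\delta v_i$ are non-negative integers. Write $\mathscr X_n=\mathbb T^d\times[-U_n,U_n]^d$, $F_0=f_0\mathbf 1_{\mathscr X_0}$, and for $n=1,\dots,N$ $$F_n=\big(\mathscr R([F_{n-1}\circ\widehat\Psi_{t_{n-1},t_n}]\,\mathbf 1_{\mathscr X_n})\big)\mathbf 1_{\mathscr X_n},$$ where $U_n=U_{n-1}$ if $|F_{n-1}|\le\epsilon_0$ at all grid points with $U_{n-1}-\Xi_n\le|v|_{\ell^\infty}\le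 U_{n-1}$, and $U_n=U_{n-1}+\Xi_n$ otherwise. *Claim.* There is a constant $C>0$, independent of $N$ (hence of $\tau$), $\delta y$, $\epsilon_0$, $U_0$, $\Xi$ and $R$, and depending on the numerical flow only through $A,B,Q,\gamma,p_0$, such that for every $R>0$ $$\sup_{(x,v)\in\mathbb T^d\times[-R,R]^d}\big(\mathbb E|F_N(x,v)-f(T,x,v)|^2\big)^{1/2}\le C\max(R,1)^\gamma\,\tau^Q+C\,\tau^{-1}(h^2+\epsilon_0).$$ -/

import Mathlib

open MeasureTheory ProbabilityTheory Filter Topology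
open scoped NNReal ENNReal

/-! ### Phase space

The torus is `𝕋^d = (ℝ / L ℤ)^d`.  Functions on `𝕋^d` or on `𝕋^d × ℝ^d` are represented by functions
on `ℝ^d` or `ℝ^d × ℝ^d` that are `L`-periodic in every position coordinate; maps of `𝕋^d × ℝ^d`
are represented by their lifts to `ℝ^d × ℝ^d`. -/

/-- Vectors of `ℝ^d` with the Euclidean norm. -/
abbrev Vec (d : ℕ) : Type := EuclideanSpace ℝ (Fin d)

/-- Phase space points `y = (x, v)`: the coordinates `Sum.inl i` are the positions `x_i`,
the coordinates `Sum.inr i` are the velocities `v_i`. -/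
abbrev Phase (d : ℕ) : Type := EuclideanSpace ℝ (Fin d ⊕ Fin d)

namespace Phase

/-- The position `x` of `(x, v)`. -/
def pos {d : ℕ} (z : Phase d) : Vec d := WithLp.toLp 2 fun i => z (Sum.inl i)

/-- The velocity `v` of `(x, v)`. -/
def vel {d : ℕ} (z : Phase d) : Vec d := WithLp.toLp 2 fun i => z (Sum.inr i)

/-- The `ℓ^∞` norm `|v|_{ℓ^∞}` of the velocity of `(x, v)`. -/
noncomputable def velSup {d : ℕ} (z : Phase d) : ℝ := ‖fun i : Fin d => z (Sum.inr i)‖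

/-- `(x, v)` and `(x', v')` represent the same point of `𝕋^d × ℝ^d`. -/
def LatticeEquiv (L : ℝ) {d : ℕ} (z w : Phase d) : Prop :=
  (∀ i : Fin d, ∃ m : ℤ, w (Sum.inl i) = z (Sum.inl i) + m * L) ∧
    ∀ i : Fin d, w (Sum.inr i) = z (Sum.inr i)

/-- `G` is the lift of a map of `𝕋^d × ℝ^d` to itself. -/
def IsTorusMap (L : ℝ) {d : ℕ} (G : Phase d → Phase d) : Prop :=
  ∀ z w, LatticeEquiv L z w → LatticeEquiv L (G z) (G w)

/-- The Euclidean distance on `𝕋^d × ℝ^d`. -/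
noncomputable def torusDist (L : ℝ) {d : ℕ} (z w : Phase d) : ℝ :=
  √(∑ i : Fin d, ‖((z (Sum.inl i) - w (Sum.inl i) : ℝ) : AddCircle L)‖ ^ 2
    + ∑ i : Fin d, (z (Sum.inr i) - w (Sum.inr i)) ^ 2)

/-- The box `𝕋^d × [-U, U]^d`. -/
def velBox (d : ℕ) (U : ℝ) : Set (Phase d) := {z | velSup z ≤ U}

/-- The fundamental cell `[0, L)^d × ℝ^d` of `𝕋^d × ℝ^d`. -/
def fundamentalCell (d : ℕ) (L : ℝ) : Set (Phase d) :=
  {z | ∀ i : Fin d, z (Sum.inl i) ∈ Set.Ico 0 L}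

end Phase

/-- `g` is `L`-periodic in every coordinate, i.e. it is a function on `𝕋^d`. -/
def IsPeriodicVec (L : ℝ) {d : ℕ} {Y : Type*} (g : Vec d → Y) : Prop :=
  ∀ x x' : Vec d, (∀ i, ∃ m : ℤ, x' i = x i + m * L) → g x' = g x

/-! ### The data of the stochastic linear Vlasov equation -/

/-- The coefficients: a Lipschitz external field `E : [0, T] × 𝕋^d → ℝ^d` and globally Lipschitz
noise coefficients `σ_1, …, σ_K : 𝕋^d → ℝ^d`. -/
structure IsLipschitzData (L : ℝ) (T : ℝ≥0) {d K : ℕ} (E : ℝ → Vec d → Vec d)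
    (σ : Fin K → Vec d → Vec d) : Prop where
  periodic_E : ∀ t ∈ Set.Icc (0 : ℝ) T, IsPeriodicVec L (E t)
  lipschitz_E : ∃ c : ℝ≥0,
    LipschitzOnWith c (fun p : ℝ × Vec d => E p.1 p.2) (Set.Icc (0 : ℝ) T ×ˢ Set.univ)
  periodic_σ : ∀ k, IsPeriodicVec L (σ k)
  lipschitz_σ : ∃ c : ℝ≥0, ∀ k, LipschitzWith c (σ k)

/-- The initial density: non-negative, globally Lipschitz, of unit mass on `𝕋^d × ℝ^d`,
twice continuously differentiable with bounded second derivatives, and decaying in velocity. -/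
structure IsInitialDensity (L : ℝ) {d : ℕ} (f₀ : Phase d → ℝ) : Prop where
  periodic : ∀ z w, Phase.LatticeEquiv L z w → f₀ w = f₀ z
  nonneg : ∀ z, 0 ≤ f₀ z
  lipschitz : ∃ c : ℝ≥0, LipschitzWith c f₀
  mass_one : ∫⁻ z in Phase.fundamentalCell d L, ENNReal.ofReal (f₀ z) = 1
  contDiff : ContDiff ℝ 2 f₀
  bounded_second : ∃ c : ℝ, ∀ z, ‖iteratedFDeriv ℝ 2 f₀ z‖ ≤ c
  decay : ∀ ε > 0, ∃ U > 0, ∀ z, z ∉ Phase.velBox d U → |f₀ z| < ε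

/-- `β = (β_1, …, β_K)` is a standard `K`-dimensional Brownian motion. -/
structure IsStandardBrownian {Ω : Type*} [MeasurableSpace Ω] (P : Measure Ω) {K : ℕ}
    (β : Fin K → ℝ≥0 → Ω → ℝ) : Prop where
  measurable : ∀ k t, Measurable (β k t)
  brownian : ∀ k, IsBrownianReal (β k) P
  indep : iIndepFun (fun k ω t => β k t ω) P

/-- The σ-algebra `𝓕_{r,t}` generated by the increments `β(s₂) - β(s₁)`, `r ≤ s₁ ≤ s₂ ≤ t`. -/
@[reducible] def incrementAlgebra {Ω : Type*} {K : ℕ} (β : Fin K → ℝ≥0 → Ω → ℝ) (r t : ℝ≥0) :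
    MeasurableSpace Ω :=
  ⨆ (k : Fin K) (s₁ : ℝ≥0) (s₂ : ℝ≥0) (_ : r ≤ s₁ ∧ s₁ ≤ s₂ ∧ s₂ ≤ t),
    MeasurableSpace.comap (fun ω => β k s₂ ω - β k s₁ ω) inferInstance

/-- `J` is the Itô integral `∫_0^t H dB`: the limit in probability of the left-endpoint Riemann
sums over the uniform partitions of `[0, t]`.  It is only used for adapted integrands `H` with
continuous paths, for which this limit exists and is the Itô integral. -/
def IsItoIntegral {Ω : Type*} [MeasurableSpace Ω] (P : Measure Ω) (H B : ℝ≥0 → Ω → ℝ) (t : ℝ≥0)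
    (J : Ω → ℝ) : Prop :=
  TendstoInMeasure P
    (fun (m : ℕ) (ω : Ω) => ∑ i ∈ Finset.range m,
      H (i * t / m) ω * (B ((i + 1) * t / m) ω - B (i * t / m) ω))
    atTop J

/-- `φ t ω = φ_{0,t}` is the stochastic flow of homeomorphisms on `[0, T]` of
`dX = V dt`, `dV = E(t, X) dt + ∑_k σ_k(X) dβ_k`, and `φinv t ω` is the inverse map of `φ t ω`. -/
structure IsStochasticFlow {Ω : Type*} [MeasurableSpace Ω] (P : Measure Ω) (L : ℝ) (T : ℝ≥0)
    {d K : ℕ} (E : ℝ → Vec d → Vec d) (σ : Fin K → Vec d → Vec d) (β : Fin K → ℝ≥0 → Ω → ℝ)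
    (φ φinv : ℝ≥0 → Ω → Phase d → Phase d) : Prop where
  adapted : ∀ t ≤ T, ∀ z,
    @AEStronglyMeasurable Ω (Phase d) _ (incrementAlgebra β 0 t) _ (fun ω => φ t ω z) P
  adapted_inv : ∀ t ≤ T, ∀ z,
    @AEStronglyMeasurable Ω (Phase d) _ (incrementAlgebra β 0 t) _ (fun ω => φinv t ω z) P
  torusMap : ∀ᵐ ω ∂P, ∀ t ≤ T, Phase.IsTorusMap L (φ t ω)
  homeomorph : ∀ᵐ ω ∂P, ∀ t ≤ T, Continuous (φ t ω) ∧ Continuous (φinv t ω) ∧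
    Function.LeftInverse (φinv t ω) (φ t ω) ∧ Function.RightInverse (φinv t ω) (φ t ω)
  continuous_paths : ∀ᵐ ω ∂P, ∀ z, ContinuousOn (fun t => φ t ω z) (Set.Iic T)
  position_eq : ∀ t ≤ T, ∀ z, ∀ i : Fin d, ∀ᵐ ω ∂P,
    (φ t ω z).pos i = z.pos i + ∫ s in (0 : ℝ)..t, (φ s.toNNReal ω z).vel i
  velocity_eq : ∀ t ≤ T, ∀ z, ∀ i : Fin d, ∃ J : Fin K → Ω → ℝ,
    (∀ k, IsItoIntegral P (fun s ω => σ k (φ s ω z).pos i) (β k) t (J k)) ∧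
    ∀ᵐ ω ∂P, (φ t ω z).vel i = z.vel i
      + (∫ s in (0 : ℝ)..t, E s (φ s.toNNReal ω z).pos i) + ∑ k, J k ω

/-- The solution `f(t, x, v) = f₀(φ_{0,t}^{-1}(x, v))` of the stochastic Vlasov equation. -/
def vlasovSolution {Ω : Type*} {d : ℕ} (f₀ : Phase d → ℝ) (φinv : ℝ≥0 → Ω → Phase d → Phase d)
    (t : ℝ≥0) (ω : Ω) (z : Phase d) : ℝ :=
  f₀ (φinv t ω z)

/-! ### Numerical flows

One-step maps are indexed by the left end of the step: `Ψ n ω = Ψ_{t_n, t_{n+1}}`. -/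

/-- The time grid `t_n = n T / N`. -/
noncomputable def gridTime (T : ℝ≥0) (N n : ℕ) : ℝ≥0 := n * (T / N)

/-- The flow `Ψ_{0,t_n} = Ψ_{t_{n-1},t_n} ∘ ⋯ ∘ Ψ_{0,t_1}`. -/
def composedFlow {X : Type*} (Ψ : ℕ → X → X) : ℕ → X → X
  | 0 => id
  | n + 1 => Ψ n ∘ composedFlow Ψ n

/-- The inverse flow `Ψ_{0,t_n}^{-1} = Ψ_{0,t_1}^{-1} ∘ ⋯ ∘ Ψ_{t_{n-1},t_n}^{-1}`. -/
def composedInverseFlow {X : Type*} (Ψinv : ℕ → X → X) : ℕ → X → X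
  | 0 => id
  | n + 1 => composedInverseFlow Ψinv n ∘ Ψinv n

/-- The bound `τ ‖E‖_{L^∞(ℓ^∞)} + ∑_k ‖σ_k‖_{L^∞(ℓ^∞)} |β_k(t_{n+1}) - β_k(t_n)|` for the velocity
displacement in the step from `t_n` to `t_{n+1}`. -/
noncomputable def velocityStepBound {Ω : Type*} (T : ℝ≥0) {d K : ℕ} (E : ℝ → Vec d → Vec d)
    (σ : Fin K → Vec d → Vec d) (β : Fin K → ℝ≥0 → Ω → ℝ) (N n : ℕ) (ω : Ω) : ℝ :=
  (T : ℝ) / N * (⨆ p : Set.Icc (0 : ℝ) T × Vec d, ‖(E p.1 p.2).ofLp‖)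
    + ∑ k, (⨆ x : Vec d, ‖(σ k x).ofLp‖) *
        |β k (gridTime T N (n + 1)) ω - β k (gridTime T N n) ω|

/-- `Ψ n`, `n < N`, are the one-step maps of a volume-preserving integrator with `N` steps, and
`Ψinv n` are their inverse maps; the inverse step only uses the noise of that step and moves the
velocity by at most `velocityStepBound`. -/
structure IsVolumePreservingIntegrator {Ω : Type*} (L : ℝ) (T : ℝ≥0)
    {d K : ℕ} (E : ℝ → Vec d → Vec d) (σ : Fin K → Vec d → Vec d) (β : Fin K → ℝ≥0 → Ω → ℝ)
    (N : ℕ) (Ψ Ψinv : ℕ → Ω → Phase d → Phase d) : Prop where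
  torusMap : ∀ n < N, ∀ ω, Phase.IsTorusMap L (Ψ n ω)
  leftInverse : ∀ n < N, ∀ ω, Function.LeftInverse (Ψinv n ω) (Ψ n ω)
  rightInverse : ∀ n < N, ∀ ω, Function.RightInverse (Ψinv n ω) (Ψ n ω)
  contDiff : ∀ n < N, ∀ ω, ContDiff ℝ 2 (Ψ n ω)
  contDiff_inv : ∀ n < N, ∀ ω, ContDiff ℝ 2 (Ψinv n ω)
  volume_preserving : ∀ n < N, ∀ ω z, (fderiv ℝ (Ψ n ω) z).det = 1
  adapted : ∀ n < N, ∀ z,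
    Measurable[incrementAlgebra β (gridTime T N n) (gridTime T N (n + 1))] fun ω => Ψinv n ω z
  velocity_step : ∀ n < N, ∀ ω z,
    ‖((Ψinv n ω z).vel - z.vel).ofLp‖ ≤ velocityStepBound T E σ β N n ω

/-- Stability with constants `A p`: for `j = 1, 2` and `p ≥ 2`,
`𝔼 ‖D^j Ψ_{0,t_n}‖^p + 𝔼 ‖D^j Ψ_{0,t_n}^{-1}‖^p ≤ A p` at every point, `0 ≤ n ≤ N`. -/
def IsStableFlow {Ω : Type*} [MeasurableSpace Ω] (P : Measure Ω) {d : ℕ} (N : ℕ)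
    (Ψ Ψinv : ℕ → Ω → Phase d → Phase d) (A : ℝ → ℝ≥0) : Prop :=
  ∀ j ∈ ({1, 2} : Set ℕ), ∀ p : ℝ, 2 ≤ p → ∀ n ≤ N, ∀ z : Phase d,
    (∫⁻ ω, ‖iteratedFDeriv ℝ j (composedFlow (fun m => Ψ m ω) n) z‖ₑ ^ p ∂P)
      + (∫⁻ ω, ‖iteratedFDeriv ℝ j (composedInverseFlow (fun m => Ψinv m ω) n) z‖ₑ ^ p ∂P)
      ≤ A p

/-- Convergence of order `Q` in `L^{2 p₀}` with growth exponent `γ` and constant `B`: at every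
`(x, v)` and for `0 ≤ n ≤ N`, with `τ = T / N`,
`(𝔼 ‖Ψ_{0,t_n}^{-1} - φ_{0,t_n}^{-1}‖^{2p₀})^{1/(2p₀)} ≤ B τ^Q (1 + ‖x‖^{2γ} + ‖v‖^{2γ})^{1/2}`. -/
def IsConvergentFlow {Ω : Type*} [MeasurableSpace Ω] (P : Measure Ω) (L : ℝ) (T : ℝ≥0) {d : ℕ} (N : ℕ)
    (Ψinv : ℕ → Ω → Phase d → Phase d) (φinv : ℝ≥0 → Ω → Phase d → Phase d)
    (Q γ p₀ : ℝ) (B : ℝ≥0) : Prop :=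
  ∀ n ≤ N, ∀ z : Phase d,
    (∫⁻ ω, ENNReal.ofReal (Phase.torusDist L (composedInverseFlow (fun m => Ψinv m ω) n z)
        (φinv (gridTime T N n) ω z)) ^ (2 * p₀) ∂P) ^ (1 / (2 * p₀))
      ≤ ENNReal.ofReal (B * ((T : ℝ) / N) ^ Q *
          (1 + ‖z.pos‖ ^ (2 * γ) + ‖z.vel‖ ^ (2 * γ)) ^ (1 / 2 : ℝ))

/-! ### Lagrange first-order interpolation -/

/-- The grid point `(l_1 δy_1, …, l_{2d} δy_{2d})`. -/
def gridPoint {d : ℕ} (δ : Fin d ⊕ Fin d → ℝ) (l : Fin d ⊕ Fin d → ℤ) : Phase d :=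
  WithLp.toLp 2 fun i => l i * δ i

/-- The Lagrange basis on the interval `[ξ δ, (ξ + 1) δ]`, for the nodes `l = ξ` and `l = ξ + 1`. -/
noncomputable def lagrangeBasis (ξ l : ℤ) (δ z : ℝ) : ℝ :=
  if l = ξ then ((ξ + 1) * δ - z) / δ else (z - ξ * δ) / δ

/-- The Lagrange first-order interpolation on phase space: on the cell
`∏_i [ξ_i δy_i, (ξ_i + 1) δy_i]` it is the multilinear interpolation of the values at the vertices.
(The values on common faces of cells do not depend on the choice of the cell.) -/
noncomputable def interpolate {d : ℕ} (δ : Fin d ⊕ Fin d → ℝ) (g : Phase d → ℝ) (y : Phase d) : ℝ :=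
  ∑ l ∈ Fintype.piFinset fun i => ({⌊y i / δ i⌋, ⌊y i / δ i⌋ + 1} : Finset ℤ),
    g (gridPoint δ l) * ∏ i, lagrangeBasis ⌊y i / δ i⌋ (l i) (δ i) (y i)

/-! ### The dynamic domain semi-Lagrangian method -/

open Classical in
/-- The update of the size of the velocity domain: it stays `U` if `|F| ≤ ε₀` at all grid points of
`𝕋^d × [-U, U]^d` with `|v|_{ℓ^∞} ≥ U - ξ`, and becomes `U + ξ` otherwise. -/
noncomputable def nextDomain {d : ℕ} (δ : Fin d ⊕ Fin d → ℝ) (ε₀ ξ U : ℝ) (F : Phase d → ℝ) : ℝ :=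
  if ∀ l : Fin d ⊕ Fin d → ℤ, gridPoint δ l ∈ Phase.velBox d U →
      U - ξ ≤ (gridPoint δ l).velSup → |F (gridPoint δ l)| ≤ ε₀
  then U else U + ξ

/-- The pair `(U_n, F_n)` computed by the method along one sample path, where `Ψinv n` is the inverse
one-step map of the step from `t_n` to `t_{n+1}` and `ξ n` the domain increment of that step:
`F_0 = f₀ 1_{𝒳_0}` and `F_{n+1} = R([F_n ∘ Ψinv n] 1_{𝒳_{n+1}}) 1_{𝒳_{n+1}}`,
with `𝒳_n = 𝕋^d × [-U_n, U_n]^d` and `R` the Lagrange first-order interpolation. -/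
noncomputable def semiLagrangianState {d : ℕ} (f₀ : Phase d → ℝ) (δ : Fin d ⊕ Fin d → ℝ)
    (ε₀ U₀ : ℝ) (ξ : ℕ → ℝ) (Ψinv : ℕ → Phase d → Phase d) : ℕ → ℝ × (Phase d → ℝ)
  | 0 => (U₀, (Phase.velBox d U₀).indicator f₀)
  | n + 1 =>
    let s := semiLagrangianState f₀ δ ε₀ U₀ ξ Ψinv n
    let U := nextDomain δ ε₀ (ξ n) s.1 s.2
    (U, (Phase.velBox d U).indicator
      (interpolate δ ((Phase.velBox d U).indicator (s.2 ∘ Ψinv n))))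

/-- The numerical solution `F_n`. -/
noncomputable def semiLagrangianSolution {d : ℕ} (f₀ : Phase d → ℝ) (δ : Fin d ⊕ Fin d → ℝ)
    (ε₀ U₀ : ℝ) (ξ : ℕ → ℝ) (Ψinv : ℕ → Phase d → Phase d) (n : ℕ) : Phase d → ℝ :=
  (semiLagrangianState f₀ δ ε₀ U₀ ξ Ψinv n).2

/-- The admissible parameters of the method for `N` steps: positive phase space stepsizes `δ`,
a threshold `ε₀ > 0`, an initial domain size `U₀` outside of which `f₀` is below the threshold,
and random domain increments `Ξ n` that dominate the velocity displacement of the step;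
`L`, `U₀` and `Ξ n` are multiples of the respective stepsizes. -/
structure IsAdmissible {Ω : Type*} [MeasurableSpace Ω] (L : ℝ) (T : ℝ≥0)
    {d K : ℕ} (E : ℝ → Vec d → Vec d) (σ : Fin K → Vec d → Vec d) (β : Fin K → ℝ≥0 → Ω → ℝ)
    (f₀ : Phase d → ℝ) (N : ℕ) (δ : Fin d ⊕ Fin d → ℝ) (ε₀ U₀ : ℝ) (Ξ : ℕ → Ω → ℝ) : Prop where
  step_pos : ∀ i, 0 < δ i
  threshold_pos : 0 < ε₀
  U₀_pos : 0 < U₀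
  below_threshold : ∀ z, z ∉ Phase.velBox d U₀ → |f₀ z| < ε₀
  measurable_Ξ : ∀ n < N, Measurable (Ξ n)
  dominates : ∀ n < N, ∀ ω, velocityStepBound T E σ β N n ω ≤ Ξ n ω
  L_multiple : ∀ i : Fin d, ∃ m : ℕ, L = m * δ (Sum.inl i)
  U₀_multiple : ∀ i : Fin d, ∃ m : ℕ, U₀ = m * δ (Sum.inr i)
  Ξ_multiple : ∀ n < N, ∀ ω, ∀ i : Fin d, ∃ m : ℕ, Ξ n ω = m * δ (Sum.inr i)

/-! Write `ψ_n` for the inverse one-step maps and `f_n = f₀ ∘ Ψ_{0,t_n}⁻¹` for the density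
transported by the numerical flow. The error splits into `F_N - f_N` and `f_N - f(T)`. The second
part is the Lipschitz constant of `f₀` times the flow error, by `eLpNorm_comp_sub_le`.

For `F_N - f_N` the difficulty is that the domain sizes are random and the increments `Ξ_n` are
merely measurable, so `F_n` need not be a function of the noise up to `t_n`. Hence the error is
first dominated path by path by `errorMajorant`, written `a_n`, which sees neither `U_n` nor `Ξ_n`
(`abs_semiLagrangianSolution_sub_le`). Truncation fits into this recursion: beyond the current
domain `f_n` itself is below `a_n`, because a foot of a characteristic either stays outside the old
domain or lands in the strip where the scheme has just checked that `|F_n| ≤ ε₀`.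

Now `a_n` depends on increments before `t_n` and `ψ_n` on increments after, so by independence
`‖a_n(ψ_n(z))‖_{L²} ≤ sup_y ‖a_n(y)‖_{L²}`. Interpolation is a convex combination and does not
increase this supremum. Each step therefore adds only `ε₀ + κ`, where `κ` is of order `h²`, and the
`L²` norm of the interpolation error of `f_{n+1}`, also of order `h²`
(`eLpNorm_interpolation_error_le`). Summing `N = T/τ` steps gives `τ⁻¹(h² + ε₀)`
(`eLpNorm_errorMajorant_le`).

The flow error is allowed to grow with `‖x‖`, so the point is first moved to the fundamental cell.
This needs the numerical and the exact solution to be periodic, i.e. the inverse maps to respect the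
lattice (`Phase.IsTorusMap.inverse`, `IsStochasticFlow.ae_isTorusMap_inv`). -/

/-! ### Multilinear interpolation as a convex combination of grid values. -/

section Interpolation

variable {d : ℕ}

/-- The vertices of the grid cell containing `y`. -/
noncomputable def cellVertices (δ : Fin d ⊕ Fin d → ℝ) (y : Phase d) :
    Finset (Fin d ⊕ Fin d → ℤ) :=
  Fintype.piFinset fun i => ({⌊y i / δ i⌋, ⌊y i / δ i⌋ + 1} : Finset ℤ)

/-- The weight of the vertex `l` in the multilinear interpolation at `y`. -/
noncomputable def vertexWeight (δ : Fin d ⊕ Fin d → ℝ) (y : Phase d) (l : Fin d ⊕ Fin d → ℤ) : ℝ :=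
  ∏ i, lagrangeBasis ⌊y i / δ i⌋ (l i) (δ i) (y i)

theorem interpolate_eq (δ : Fin d ⊕ Fin d → ℝ) (g : Phase d → ℝ) (y : Phase d) :
    interpolate δ g y = ∑ l ∈ cellVertices δ y, g (gridPoint δ l) * vertexWeight δ y l := rfl

variable {δ : Fin d ⊕ Fin d → ℝ} {y : Phase d} {l : Fin d ⊕ Fin d → ℤ}

theorem gridPoint_apply (i : Fin d ⊕ Fin d) : gridPoint δ l i = l i * δ i := rfl

theorem floor_mul_le (hδ : ∀ i, 0 < δ i) (i : Fin d ⊕ Fin d) : (⌊y i / δ i⌋ : ℝ) * δ i ≤ y i := by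
  have := Int.floor_le (y i / δ i)
  rwa [le_div_iff₀ (hδ i)] at this

theorem lt_floor_add_one_mul (hδ : ∀ i, 0 < δ i) (i : Fin d ⊕ Fin d) :
    y i < ((⌊y i / δ i⌋ : ℝ) + 1) * δ i := by
  have := Int.lt_floor_add_one (y i / δ i)
  rwa [div_lt_iff₀ (hδ i)] at this

theorem mem_cellVertices :
    l ∈ cellVertices δ y ↔ ∀ i, l i = ⌊y i / δ i⌋ ∨ l i = ⌊y i / δ i⌋ + 1 := by
  simp [cellVertices]

theorem lagrangeBasis_nonneg (hδ : ∀ i, 0 < δ i) (i : Fin d ⊕ Fin d) (m : ℤ) :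
    0 ≤ lagrangeBasis ⌊y i / δ i⌋ m (δ i) (y i) := by
  have h1 := floor_mul_le (y := y) hδ i
  have h2 := (lt_floor_add_one_mul (y := y) hδ i).le
  unfold lagrangeBasis
  split_ifs
  · exact div_nonneg (by linarith) (hδ i).le
  · exact div_nonneg (by linarith) (hδ i).le

theorem vertexWeight_nonneg (hδ : ∀ i, 0 < δ i) : 0 ≤ vertexWeight δ y l :=
  Finset.prod_nonneg fun i _ => lagrangeBasis_nonneg hδ i _

theorem sum_lagrangeBasis (hδ : ∀ i, 0 < δ i) (i : Fin d ⊕ Fin d) :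
    ∑ m ∈ ({⌊y i / δ i⌋, ⌊y i / δ i⌋ + 1} : Finset ℤ),
      lagrangeBasis ⌊y i / δ i⌋ m (δ i) (y i) = 1 := by
  rw [Finset.sum_pair (by simp)]
  have := (hδ i).ne'
  simp only [lagrangeBasis, if_true, add_eq_left, one_ne_zero, if_false]
  field_simp
  ring

theorem sum_lagrangeBasis_mul (hδ : ∀ i, 0 < δ i) (i : Fin d ⊕ Fin d) :
    ∑ m ∈ ({⌊y i / δ i⌋, ⌊y i / δ i⌋ + 1} : Finset ℤ),
      m * δ i * lagrangeBasis ⌊y i / δ i⌋ m (δ i) (y i) = y i := by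
  rw [Finset.sum_pair (by simp)]
  have := (hδ i).ne'
  simp only [lagrangeBasis, if_true, add_eq_left, one_ne_zero, if_false]
  push_cast
  field_simp
  ring

theorem sum_vertexWeight (hδ : ∀ i, 0 < δ i) :
    ∑ l ∈ cellVertices δ y, vertexWeight δ y l = 1 := by
  unfold cellVertices vertexWeight
  rw [← Finset.prod_univ_sum (fun i => ({⌊y i / δ i⌋, ⌊y i / δ i⌋ + 1} : Finset ℤ))
    (fun i m => lagrangeBasis ⌊y i / δ i⌋ m (δ i) (y i))]
  exact Finset.prod_eq_one fun i _ => sum_lagrangeBasis hδ i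

theorem sum_vertexWeight_mul_coord (hδ : ∀ i, 0 < δ i) (i : Fin d ⊕ Fin d) :
    ∑ l ∈ cellVertices δ y, vertexWeight δ y l * gridPoint δ l i = y i := by
  have h := Finset.prod_univ_sum (fun i => ({⌊y i / δ i⌋, ⌊y i / δ i⌋ + 1} : Finset ℤ))
    (fun j m => (if j = i then m * δ i else 1) * lagrangeBasis ⌊y j / δ j⌋ m (δ j) (y j))
  have h1 : ∀ l ∈ cellVertices δ y, vertexWeight δ y l * gridPoint δ l i
      = ∏ j, (if j = i then (l j : ℝ) * δ i else 1)
        * lagrangeBasis ⌊y j / δ j⌋ (l j) (δ j) (y j) := by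
    intro l _
    rw [Finset.prod_mul_distrib, Finset.prod_ite_eq' Finset.univ i (fun j => (l j : ℝ) * δ i),
      if_pos (Finset.mem_univ i), mul_comm]
    rfl
  rw [Finset.sum_congr rfl h1]
  refine h.symm.trans ?_
  rw [Finset.prod_eq_single i]
  · simpa using sum_lagrangeBasis_mul (y := y) hδ i
  · intro j _ hj
    simpa [hj] using sum_lagrangeBasis (y := y) hδ j
  · simp

theorem le_of_vertexWeight_ne_zero (hδ : ∀ i, 0 < δ i) (hl : l ∈ cellVertices δ y) {i : Fin d ⊕ Fin d}
    {m : ℤ} (hm : m * δ i ≤ y i) : m * δ i ≤ gridPoint δ l i := by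
  rw [gridPoint_apply]
  refine mul_le_mul_of_nonneg_right ?_ (hδ i).le
  have : m ≤ ⌊y i / δ i⌋ := Int.le_floor.2 ((le_div_iff₀ (hδ i)).2 hm)
  rcases mem_cellVertices.1 hl i with h | h <;> rw [h] <;> exact_mod_cast (by omega)

/-- A vertex could cross the hyperplane `y_i = m δ_i` from below only if `y` lies on it, and then
the upper vertex has weight zero. In the other direction rounding down never crosses, so no
condition on the weight is needed there. -/
theorem le_of_vertexWeight_ne_zero' (hδ : ∀ i, 0 < δ i) (hl : l ∈ cellVertices δ y)
    (hw : vertexWeight δ y l ≠ 0) {i : Fin d ⊕ Fin d}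
    {m : ℤ} (hm : y i ≤ m * δ i) : gridPoint δ l i ≤ m * δ i := by
  rw [gridPoint_apply]
  refine mul_le_mul_of_nonneg_right ?_ (hδ i).le
  have h1 : ⌊y i / δ i⌋ ≤ m := by
    have := Int.floor_le_floor ((div_le_iff₀ (hδ i)).2 hm)
    simpa using this
  rcases mem_cellVertices.1 hl i with h | h
  · rw [h]; exact Int.cast_le.2 h1
  · rcases h1.lt_or_eq with h2 | h2
    · rw [h]; exact Int.cast_le.2 h2
    · exfalso
      apply hw
      refine Finset.prod_eq_zero (Finset.mem_univ i) ?_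
      have h3 := floor_mul_le (y := y) hδ i
      have : y i = ⌊y i / δ i⌋ * δ i := le_antisymm (by rw [h2]; exact hm) h3
      simp only [lagrangeBasis, h, add_eq_left, one_ne_zero, if_false]
      rw [← this]; simp

theorem abs_gridPoint_sub_le (hδ : ∀ i, 0 < δ i) (hl : l ∈ cellVertices δ y) (i : Fin d ⊕ Fin d) :
    |gridPoint δ l i - y i| ≤ δ i := by
  rw [gridPoint_apply]
  have h1 := floor_mul_le (y := y) hδ i
  have h2 := (lt_floor_add_one_mul (y := y) hδ i).le
  rw [abs_le]
  rcases mem_cellVertices.1 hl i with h | h <;> rw [h] <;> push_cast <;>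
    constructor <;> nlinarith

theorem norm_gridPoint_sub_sq_le (hδ : ∀ i, 0 < δ i) (hl : l ∈ cellVertices δ y) :
    ‖gridPoint δ l - y‖ ^ 2 ≤ 2 * d * ‖δ‖ ^ 2 := by
  rw [EuclideanSpace.norm_sq_eq]
  calc ∑ i, ‖(gridPoint δ l - y) i‖ ^ 2 ≤ ∑ i : Fin d ⊕ Fin d, ‖δ‖ ^ 2 := by
        refine Finset.sum_le_sum fun i _ => ?_
        gcongr
        refine (abs_gridPoint_sub_le hδ hl i).trans ?_
        exact (le_abs_self _).trans (norm_le_pi_norm δ i)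
    _ = 2 * d * ‖δ‖ ^ 2 := by
        simp only [Finset.sum_const, Finset.card_univ, Fintype.card_sum, Fintype.card_fin,
          nsmul_eq_mul]
        push_cast; ring

theorem sum_vertexWeight_smul_sub (hδ : ∀ i, 0 < δ i) :
    ∑ l ∈ cellVertices δ y, vertexWeight δ y l • (gridPoint δ l - y) = 0 := by
  ext i
  simp only [smul_sub, Finset.sum_sub_distrib, ← Finset.sum_smul, sum_vertexWeight hδ, one_smul]
  have := sum_vertexWeight_mul_coord (y := y) hδ i
  simp [WithLp.ofLp_sum, Finset.sum_apply, this]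

variable {g g' : Phase d → ℝ}

theorem interpolate_mono (hδ : ∀ i, 0 < δ i)
    (h : ∀ l ∈ cellVertices δ y, vertexWeight δ y l ≠ 0 → g (gridPoint δ l) ≤ g' (gridPoint δ l)) :
    interpolate δ g y ≤ interpolate δ g' y := by
  rw [interpolate_eq, interpolate_eq]
  refine Finset.sum_le_sum fun l hl => ?_
  by_cases hw : vertexWeight δ y l = 0
  · simp [hw]
  · exact mul_le_mul_of_nonneg_right (h l hl hw) (vertexWeight_nonneg hδ)

theorem interpolate_congr
    (h : ∀ l ∈ cellVertices δ y, vertexWeight δ y l ≠ 0 → g (gridPoint δ l) = g' (gridPoint δ l)) :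
    interpolate δ g y = interpolate δ g' y := by
  rw [interpolate_eq, interpolate_eq]
  refine Finset.sum_congr rfl fun l hl => ?_
  by_cases hw : vertexWeight δ y l = 0
  · simp [hw]
  · rw [h l hl hw]

theorem interpolate_sub : interpolate δ g y - interpolate δ g' y = interpolate δ (g - g') y := by
  simp only [interpolate_eq, ← Finset.sum_sub_distrib, Pi.sub_apply, sub_mul]

theorem interpolate_const (hδ : ∀ i, 0 < δ i) (c : ℝ) : interpolate δ (fun _ => c) y = c := by
  rw [interpolate_eq, ← Finset.mul_sum, sum_vertexWeight hδ, mul_one]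

theorem interpolate_add_const (hδ : ∀ i, 0 < δ i) (c : ℝ) :
    interpolate δ (fun z => g z + c) y = interpolate δ g y + c := by
  simp only [interpolate_eq, add_mul, Finset.sum_add_distrib]
  rw [← Finset.mul_sum, sum_vertexWeight hδ, mul_one]

theorem abs_interpolate_le (hδ : ∀ i, 0 < δ i) :
    |interpolate δ g y| ≤ interpolate δ (fun z => |g z|) y := by
  rw [interpolate_eq, interpolate_eq]
  refine (Finset.abs_sum_le_sum_abs _ _).trans (le_of_eq ?_)
  refine Finset.sum_congr rfl fun l _ => ?_
  rw [abs_mul, abs_of_nonneg (vertexWeight_nonneg hδ)]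

theorem interpolate_gridPoint (hδ : ∀ i, 0 < δ i) (m : Fin d ⊕ Fin d → ℤ) :
    interpolate δ g (gridPoint δ m) = g (gridPoint δ m) := by
  rw [← interpolate_const (y := gridPoint δ m) hδ (g (gridPoint δ m))]
  refine interpolate_congr fun l hl hw => ?_
  congr 1
  ext i
  have e : gridPoint δ m i = m i * δ i := rfl
  exact le_antisymm (by rw [e]; exact le_of_vertexWeight_ne_zero' hδ hl hw e.le)
    (by rw [e]; exact le_of_vertexWeight_ne_zero hδ hl e.ge)

theorem Phase.abs_le_velSup (z : Phase d) (i : Fin d) : |z (Sum.inr i)| ≤ z.velSup :=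
  norm_le_pi_norm (fun i : Fin d => z (Sum.inr i)) i

theorem Phase.velSup_le_iff {z : Phase d} {r : ℝ} (hr : 0 ≤ r) :
    z.velSup ≤ r ↔ ∀ i, |z (Sum.inr i)| ≤ r :=
  pi_norm_le_iff_of_nonneg hr

theorem Phase.velSup_nonneg (z : Phase d) : 0 ≤ z.velSup := norm_nonneg _

theorem Phase.exists_abs_eq_velSup (hd : 1 ≤ d) (z : Phase d) :
    ∃ i : Fin d, |z (Sum.inr i)| = z.velSup := by
  have : Nonempty (Fin d) := ⟨⟨0, hd⟩⟩
  by_contra! h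
  have hlt : ∀ i, |z (Sum.inr i)| < z.velSup := fun i => lt_of_le_of_ne (z.abs_le_velSup i) (h i)
  have h0 : 0 < z.velSup := (abs_nonneg _).trans_lt (hlt ⟨0, hd⟩)
  have : z.velSup < z.velSup := (pi_norm_lt_iff h0).2 hlt
  exact lt_irrefl _ this

/-- When `U` is a multiple of every velocity step the box is a union of grid cells. This and the
next lemma allow the cutoff to be dropped under the interpolation, inside and outside the box. -/
theorem velSup_gridPoint_le (hδ : ∀ i, 0 < δ i) {U : ℝ} (hU : ∀ i : Fin d, ∃ m : ℤ, U = m * δ (Sum.inr i))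
    (hl : l ∈ cellVertices δ y) (hw : vertexWeight δ y l ≠ 0) (hy : y.velSup ≤ U) :
    (gridPoint δ l).velSup ≤ U := by
  have hU0 : 0 ≤ U := y.velSup_nonneg.trans hy
  rw [Phase.velSup_le_iff hU0] at hy ⊢
  intro i
  obtain ⟨m, hm⟩ := hU i
  have h := abs_le.1 (hy i)
  rw [abs_le]
  constructor
  · have : ((-m : ℤ) : ℝ) * δ (Sum.inr i) ≤ y (Sum.inr i) := by push_cast; linarith
    have := le_of_vertexWeight_ne_zero hδ hl this
    push_cast at this; linarith
  · rw [hm]; exact le_of_vertexWeight_ne_zero' hδ hl hw (by linarith)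

theorem le_velSup_gridPoint (hd : 1 ≤ d) (hδ : ∀ i, 0 < δ i) {U : ℝ} (hU : ∀ i : Fin d, ∃ m : ℤ, U = m * δ (Sum.inr i))
    (hl : l ∈ cellVertices δ y) (hw : vertexWeight δ y l ≠ 0) (hy : U ≤ y.velSup) :
    U ≤ (gridPoint δ l).velSup := by
  obtain ⟨i, hi⟩ := Phase.exists_abs_eq_velSup hd y
  obtain ⟨m, hm⟩ := hU i
  refine le_trans ?_ ((gridPoint δ l).abs_le_velSup i)
  rw [← hi] at hy
  rcases le_abs.1 hy with h | h
  · refine le_trans ?_ (le_abs_self _)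
    rw [hm] at h ⊢
    exact le_of_vertexWeight_ne_zero hδ hl h
  · refine le_trans ?_ (neg_le_abs _)
    have : y (Sum.inr i) ≤ ((-m : ℤ) : ℝ) * δ (Sum.inr i) := by push_cast; linarith
    have := le_of_vertexWeight_ne_zero' hδ hl hw this
    push_cast at this; linarith

end Interpolation

/-! ### Pathwise domination of the error, independent of the velocity domains. -/

section Majorant

variable {d : ℕ}

/-- A pathwise bound for the error of the semi-Lagrangian method that does not depend on the
velocity domains. -/
noncomputable def errorMajorant (f₀ : Phase d → ℝ) (δ : Fin d ⊕ Fin d → ℝ) (ε₀ κ : ℝ)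
    (ψ : ℕ → Phase d → Phase d) : ℕ → Phase d → ℝ
  | 0 => fun _ => ε₀
  | n + 1 => fun y => interpolate δ (errorMajorant f₀ δ ε₀ κ ψ n ∘ ψ n) y
      + |interpolate δ (f₀ ∘ composedInverseFlow ψ (n + 1)) y
        - (f₀ ∘ composedInverseFlow ψ (n + 1)) y| + (ε₀ + κ)

variable {f₀ : Phase d → ℝ} {δ : Fin d ⊕ Fin d → ℝ} {ε₀ κ U₀ : ℝ} {ξ : ℕ → ℝ}
  {ψ : ℕ → Phase d → Phase d}

/-- If `f₀` is below a threshold outside a box, this also holds on the boundary of the box. -/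
theorem abs_le_of_le_velSup (hd : 1 ≤ d) (hf : Continuous f₀) (hU : 0 < U₀)
    (h : ∀ z, z ∉ Phase.velBox d U₀ → |f₀ z| < ε₀) (z : Phase d) (hz : U₀ ≤ z.velSup) :
    |f₀ z| ≤ ε₀ := by
  obtain ⟨i, hi⟩ := Phase.exists_abs_eq_velSup hd z
  -- For `t > 0` the point `(1 + t) z` lies strictly outside the box; let `t → 0`.
  have hc : Continuous fun t : ℝ => |f₀ ((1 + t) • z)| := by fun_prop
  have ht : Tendsto (fun t : ℝ => |f₀ ((1 + t) • z)|) (𝓝[>] 0) (𝓝 |f₀ z|) := by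
    have := (hc.tendsto 0).mono_left (nhdsWithin_le_nhds (s := Set.Ioi 0))
    simpa using this
  refine le_of_tendsto ht ?_
  filter_upwards [self_mem_nhdsWithin] with t ht
  refine (h _ ?_).le
  intro hmem
  have h1 := (((1 + t) • z).abs_le_velSup i).trans hmem
  have ht' : 0 < t := ht
  rw [PiLp.smul_apply, smul_eq_mul, abs_mul, hi, abs_of_pos (by linarith)] at h1
  nlinarith

theorem velSup_sub_le {y z : Phase d} {r : ℝ} (h : ‖(y.vel - z.vel).ofLp‖ ≤ r) :
    z.velSup - r ≤ y.velSup := by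
  have e : (y.vel - z.vel).ofLp = (fun i : Fin d => y (Sum.inr i)) - fun i : Fin d => z (Sum.inr i) :=
    rfl
  rw [e] at h
  have := norm_sub_norm_le (fun i : Fin d => z (Sum.inr i)) (fun i : Fin d => y (Sum.inr i))
  rw [norm_sub_rev] at this
  unfold Phase.velSup
  linarith

/-- Inside the new box the error is interpolated from the feet of the characteristics and gains the
interpolation error of `f_{n+1}`. Outside, `F_{n+1} = 0`, so `f_{n+1}` itself must be controlled;
this costs the additional `ε₀ + κ` in the majorant. -/
theorem abs_semiLagrangianSolution_sub_le (hd : 1 ≤ d) (hf : Continuous f₀) (hδ : ∀ i, 0 < δ i)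
    (hε : 0 < ε₀) (hU : 0 < U₀) (hout : ∀ z, z ∉ Phase.velBox d U₀ → |f₀ z| < ε₀)
    (hκ : ∀ z, |interpolate δ f₀ z - f₀ z| ≤ κ) {N : ℕ}
    (hvel : ∀ n < N, ∀ z, ‖((ψ n z).vel - z.vel).ofLp‖ ≤ ξ n)
    (hU₀ : ∀ i : Fin d, ∃ m : ℕ, U₀ = m * δ (Sum.inr i))
    (hξ : ∀ n < N, ∀ i : Fin d, ∃ m : ℕ, ξ n = m * δ (Sum.inr i)) (z : Phase d) :
    |semiLagrangianSolution f₀ δ ε₀ U₀ ξ ψ N z - f₀ (composedInverseFlow ψ N z)|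
      ≤ errorMajorant f₀ δ ε₀ κ ψ N z := by
  have hκ0 : 0 ≤ κ := (abs_nonneg _).trans (hκ z)
  set Un : ℕ → ℝ := fun n => (semiLagrangianState f₀ δ ε₀ U₀ ξ ψ n).1 with hUn
  set F : ℕ → Phase d → ℝ := fun n => (semiLagrangianState f₀ δ ε₀ U₀ ξ ψ n).2 with hF
  set a : ℕ → Phase d → ℝ := errorMajorant f₀ δ ε₀ κ ψ with ha
  set f : ℕ → Phase d → ℝ := fun n => f₀ ∘ composedInverseFlow ψ n with hfn
  have ha_succ : ∀ n y, a (n + 1) y = interpolate δ (a n ∘ ψ n) y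
      + |interpolate δ (f (n + 1)) y - f (n + 1) y| + (ε₀ + κ) := fun n y => rfl
  have hf_succ : ∀ n y, f (n + 1) y = f n (ψ n y) := fun n y => rfl
  have hF_succ : ∀ n, F (n + 1) = (Phase.velBox d (Un (n + 1))).indicator
      (interpolate δ ((Phase.velBox d (Un (n + 1))).indicator (F n ∘ ψ n))) := fun n => rfl
  have hU_succ : ∀ n, Un (n + 1) = nextDomain δ ε₀ (ξ n) (Un n) (F n) := fun n => rfl
  -- Invariants: the box is aligned with the grid; `F_n` is close to its own interpolant there; the
  -- exact density is dominated beyond the box; the error is dominated everywhere. The second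
  -- invariant needs `κ` only for `n = 0`, since later `F_n` equals its interpolant on the box.
  suffices H : ∀ n ≤ N, (∀ i : Fin d, ∃ m : ℤ, Un n = m * δ (Sum.inr i)) ∧
      (∀ y, y ∈ Phase.velBox d (Un n) → |F n y - interpolate δ (F n) y| ≤ κ) ∧
      (∀ y, Un n ≤ y.velSup → |f n y| ≤ a n y) ∧ (∀ y, |F n y - f n y| ≤ a n y) from (H N le_rfl).2.2.2 z
  intro n
  induction n with
  | zero =>
    intro _
    have hF0 : F 0 = (Phase.velBox d U₀).indicator f₀ := rfl
    have hmul : ∀ i : Fin d, ∃ m : ℤ, Un 0 = m * δ (Sum.inr i) := by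
      intro i
      obtain ⟨m, hm⟩ := hU₀ i
      exact ⟨m, by rw [Int.cast_natCast]; exact hm⟩
    refine ⟨hmul, ?_, ?_, ?_⟩
    · intro y hy
      have : interpolate δ (F 0) y = interpolate δ f₀ y := by
        refine interpolate_congr fun l hl hw => ?_
        have hm : gridPoint δ l ∈ Phase.velBox d U₀ := velSup_gridPoint_le hδ hmul hl hw hy
        rw [hF0, Set.indicator_of_mem hm]
      have hy' : y ∈ Phase.velBox d U₀ := hy
      rw [this, hF0, Set.indicator_of_mem hy', abs_sub_comm]
      exact hκ y
    · exact fun y hy => abs_le_of_le_velSup hd hf hU hout y hy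
    · intro y
      change |F 0 y - f₀ y| ≤ ε₀
      rw [hF0]
      by_cases hy : y ∈ Phase.velBox d U₀
      · rw [Set.indicator_of_mem hy, sub_self, abs_zero]; exact hε.le
      · rw [Set.indicator_of_notMem hy, zero_sub, abs_neg]; exact (hout y hy).le
  | succ n ih =>
    intro hn
    obtain ⟨hmul, hint, hext, herr⟩ := ih (by omega)
    have hn' : n < N := by omega
    have hξ0 : 0 ≤ ξ n := (norm_nonneg _).trans (hvel n hn' z)
    have hξZ : ∀ i : Fin d, ∃ m : ℤ, ξ n = m * δ (Sum.inr i) := by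
      intro i
      obtain ⟨m, hm⟩ := hξ n hn' i
      exact ⟨m, by rw [Int.cast_natCast]; exact hm⟩
    -- the two cases of the domain update
    have hcase : (Un (n + 1) = Un n ∧ ∀ l, gridPoint δ l ∈ Phase.velBox d (Un n) →
        Un n - ξ n ≤ (gridPoint δ l).velSup → |F n (gridPoint δ l)| ≤ ε₀) ∨
        Un (n + 1) = Un n + ξ n := by
      rw [hU_succ]
      unfold nextDomain
      split_ifs with h
      · exact Or.inl ⟨rfl, h⟩
      · exact Or.inr rfl
    have hmul' : ∀ i : Fin d, ∃ m : ℤ, Un (n + 1) = m * δ (Sum.inr i) := by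
      intro i
      obtain ⟨m, hm⟩ := hmul i
      obtain ⟨k, hk⟩ := hξZ i
      rcases hcase with h | h
      · exact ⟨m, h.1.trans hm⟩
      · exact ⟨m + k, by rw [h, hm, hk]; push_cast; ring⟩
    -- the exact density outside the new domain
    have hfψ : ∀ y, Un (n + 1) ≤ y.velSup → |f (n + 1) y| ≤ a n (ψ n y) + (ε₀ + κ) := by
      intro y hy
      rw [hf_succ]
      have hv := velSup_sub_le (hvel n hn' y)
      by_cases hb : Un n ≤ (ψ n y).velSup
      · have := hext _ hb
        linarith
      · push Not at hb
        rcases hcase with ⟨h, hstrip⟩ | h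
        -- The domain was kept, and the foot lies in the tested strip. All vertices carrying weight
        -- lie in that strip too, so the interpolant of `F_n` is at most `ε₀` there; passing to
        -- `F_n` costs `κ` and passing to `f_n` costs `a_n`.
        · have hlow : Un n - ξ n ≤ (ψ n y).velSup := by linarith
          have hmulx : ∀ i : Fin d, ∃ m : ℤ, Un n - ξ n = m * δ (Sum.inr i) := by
            intro i
            obtain ⟨m, hm⟩ := hmul i
            obtain ⟨k, hk⟩ := hξZ i
            exact ⟨m - k, by rw [hm, hk]; push_cast; ring⟩
          have h1 : |interpolate δ (F n) (ψ n y)| ≤ ε₀ := by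
            refine (abs_interpolate_le hδ).trans ?_
            rw [← interpolate_const (y := ψ n y) hδ ε₀]
            refine interpolate_mono hδ fun l hl hw => ?_
            exact hstrip l (velSup_gridPoint_le hδ hmul hl hw hb.le)
              (le_velSup_gridPoint hd hδ hmulx hl hw hlow)
          have h2 := hint (ψ n y) hb.le
          have h3 := herr (ψ n y)
          rw [abs_le] at *
          constructor <;> linarith [h1.1, h1.2, h2.1, h2.2, h3.1, h3.2]
        -- After an enlargement by `ξ` no foot from outside the new box can reach the interior of
        -- the old one.
        · linarith
    have hext' : ∀ y, Un (n + 1) ≤ y.velSup → |f (n + 1) y| ≤ a (n + 1) y := by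
      intro y hy
      have h1 : |interpolate δ (f (n + 1)) y| ≤ interpolate δ (a n ∘ ψ n) y + (ε₀ + κ) := by
        rw [← interpolate_add_const hδ]
        refine (abs_interpolate_le hδ).trans (interpolate_mono hδ fun l hl hw => ?_)
        exact hfψ _ (le_velSup_gridPoint hd hδ hmul' hl hw hy)
      rw [ha_succ]
      have h2 := abs_sub_abs_le_abs_sub (f (n + 1) y) (interpolate δ (f (n + 1)) y)
      rw [abs_sub_comm] at h2
      linarith
    refine ⟨hmul', ?_, hext', ?_⟩
    · intro y hy
      have : interpolate δ (F (n + 1)) y = interpolate δ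
          ((Phase.velBox d (Un (n + 1))).indicator (F n ∘ ψ n)) y := by
        refine interpolate_congr fun l hl hw => ?_
        have hm : gridPoint δ l ∈ Phase.velBox d (Un (n + 1)) :=
          velSup_gridPoint_le hδ hmul' hl hw hy
        rw [hF_succ, Set.indicator_of_mem hm, interpolate_gridPoint hδ]
      rw [this, hF_succ, Set.indicator_of_mem hy, sub_self, abs_zero]
      exact hκ0
    · intro y
      by_cases hy : y ∈ Phase.velBox d (Un (n + 1))
      · have h1 : F (n + 1) y = interpolate δ (F n ∘ ψ n) y := by
          rw [hF_succ, Set.indicator_of_mem hy]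
          refine interpolate_congr fun l hl hw => ?_
          have hm : gridPoint δ l ∈ Phase.velBox d (Un (n + 1)) :=
            velSup_gridPoint_le hδ hmul' hl hw hy
          exact Set.indicator_of_mem hm _
        have h2 : |F (n + 1) y - interpolate δ (f (n + 1)) y| ≤ interpolate δ (a n ∘ ψ n) y := by
          rw [h1, interpolate_sub]
          refine (abs_interpolate_le hδ).trans (interpolate_mono hδ fun l _ _ => ?_)
          exact herr _
        have h3 := abs_sub_le (F (n + 1) y) (interpolate δ (f (n + 1)) y) (f (n + 1) y)
        rw [ha_succ]
        linarith
      · have : F (n + 1) y = 0 := by rw [hF_succ]; exact Set.indicator_of_notMem hy _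
        rw [this, zero_sub, abs_neg]
        exact hext' y (not_le.1 hy).le

end Majorant

/-! ### Independence of past and future increments. -/

section Independence

theorem iIndepFun_bool_of_indepFun {Ω S : Type*} {mΩ : MeasurableSpace Ω} [MeasurableSpace S]
    {P : Measure Ω} [IsProbabilityMeasure P] {X : Bool → Ω → S} (h : IndepFun (X false) (X true) P) :
    iIndepFun X P := by
  rw [iIndepFun_iff_measure_inter_preimage_eq_mul]
  have hsub : ∀ u : Finset Bool, u = ∅ ∨ u = {false} ∨ u = {true} ∨ u = {false, true} := by
    decide
  intro u V hV
  rcases hsub u with rfl | rfl | rfl | rfl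
  · simp
  · simp
  · simp
  · have h2 := h.measure_inter_preimage_eq_mul _ _ (hV false (by simp)) (hV true (by simp))
    rw [Finset.prod_pair (by simp), ← h2]
    congr 1
    ext ω
    simp

variable {Ω : Type*} {mΩ : MeasurableSpace Ω} {P : Measure Ω} {K : ℕ} {β : Fin K → ℝ≥0 → Ω → ℝ}

theorem incrementAlgebra_le (hβ : ∀ k t, Measurable (β k t)) (r t : ℝ≥0) :
    incrementAlgebra β r t ≤ mΩ := by
  refine iSup_le fun k => iSup_le fun s₁ => iSup_le fun s₂ => iSup_le fun _ => ?_
  exact ((hβ k s₂).sub (hβ k s₁)).comap_le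

theorem incrementAlgebra_mono {r r' t t' : ℝ≥0} (hr : r' ≤ r) (ht : t ≤ t') :
    incrementAlgebra β r t ≤ incrementAlgebra β r' t' := by
  refine iSup_le fun k => iSup_le fun s₁ => iSup_le fun s₂ => iSup_le fun h => ?_
  exact le_iSup_of_le k (le_iSup_of_le s₁ (le_iSup_of_le s₂
    (le_iSup_of_le ⟨hr.trans h.1, h.2.1, h.2.2.trans ht⟩ le_rfl)))

/-- For each component the path after `s`, recentred, is independent of the path up to `s`; the
components are independent of each other. Together all pairs (component, past or future) form one
independent family, and the two algebras live on the disjoint halves of the index set. -/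
theorem indep_incrementAlgebra [IsProbabilityMeasure P] (hβ : IsStandardBrownian P β) (s t : ℝ≥0) :
    Indep (incrementAlgebra β 0 s) (incrementAlgebra β s t) P := by
  -- The past is encoded by the stopped path `u ↦ β_k(min u s)`, so that past and future take values
  -- in the same path space.
  let X : Fin K → Bool → Ω → (ℝ≥0 → ℝ) := fun k b ω =>
    bif b then fun u => β k (s + u) ω - β k s ω else fun u => β k (min u s) ω
  have hXm : ∀ k b, Measurable (X k b) := by
    intro k b
    refine measurable_pi_lambda _ fun u => ?_
    cases b
    · exact hβ.measurable k _
    · exact (hβ.measurable k _).sub (hβ.measurable k _)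
  have hX1 : iIndepFun (fun k ω b => X k b ω) P := by
    refine (hβ.indep).comp (fun (_ : Fin K) (p : ℝ≥0 → ℝ) (b : Bool) =>
      (bif b then fun u => p (s + u) - p s else fun u => p (min u s) : ℝ≥0 → ℝ)) ?_
    intro k
    refine measurable_pi_lambda _ fun b => measurable_pi_lambda _ fun u => ?_
    cases b
    · exact measurable_pi_apply _
    · exact (measurable_pi_apply _).sub (measurable_pi_apply _)
  have hX2 : ∀ k, iIndepFun (X k) P := by
    intro k
    refine iIndepFun_bool_of_indepFun ?_
    have h := ((hβ.brownian k).indepFun_shift s).symm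
    refine h.comp (φ := fun p u => p ⟨min u s, Set.mem_Iic.2 (min_le_right u s)⟩) (ψ := id) ?_ measurable_id
    exact measurable_pi_lambda _ fun u => measurable_pi_apply _
  have hX := iIndepFun_uncurry hXm hX1 hX2
  have hle : ∀ p : (_ : Fin K) × Bool, MeasurableSpace.comap (X p.1 p.2) inferInstance ≤ mΩ :=
    fun p => (hXm p.1 p.2).comap_le
  have hdis : Disjoint {p : (_ : Fin K) × Bool | p.2 = false} {p | p.2 = true} := by
    rw [Set.disjoint_left]
    intro p h1 h2
    have h1' : p.2 = false := h1
    have h2' : p.2 = true := h2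
    simp [h1'] at h2'
  have hI := indep_iSup_of_disjoint hle hX hdis
  refine indep_of_indep_of_le_left (indep_of_indep_of_le_right hI ?_) ?_
  · refine iSup_le fun k => iSup_le fun s₁ => iSup_le fun s₂ => iSup_le fun h => ?_
    refine le_trans ?_ (le_iSup₂_of_le (⟨k, true⟩ : (_ : Fin K) × Bool) rfl le_rfl)
    rw [← measurable_iff_comap_le]
    have e : (fun ω => β k s₂ ω - β k s₁ ω) =
        (fun p : ℝ≥0 → ℝ => p (s₂ - s) - p (s₁ - s)) ∘ X k true := by
      funext ω
      simp [X, add_tsub_cancel_of_le h.1, add_tsub_cancel_of_le (h.1.trans h.2.1)]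
    rw [e]
    refine Measurable.comp ?_ (comap_measurable _)
    exact (measurable_pi_apply _).sub (measurable_pi_apply _)
  · refine iSup_le fun k => iSup_le fun s₁ => iSup_le fun s₂ => iSup_le fun h => ?_
    refine le_trans ?_ (le_iSup₂_of_le (⟨k, false⟩ : (_ : Fin K) × Bool) rfl le_rfl)
    rw [← measurable_iff_comap_le]
    have e : (fun ω => β k s₂ ω - β k s₁ ω) =
        (fun p : ℝ≥0 → ℝ => p s₂ - p s₁) ∘ X k false := by
      funext ω
      simp [X, min_eq_left h.2.2, min_eq_left (h.2.1.trans h.2.2)]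
    rw [e]
    refine Measurable.comp ?_ (comap_measurable _)
    exact (measurable_pi_apply _).sub (measurable_pi_apply _)

theorem lintegral_comp_le_of_indepFun {S S' : Type*} [MeasurableSpace S] [MeasurableSpace S']
    [IsProbabilityMeasure P] {X : Ω → S} {Y : Ω → S'} (hX : Measurable X) (hY : Measurable Y)
    (h : IndepFun X Y P) {H : S × S' → ℝ≥0∞} (hH : Measurable H) {C : ℝ≥0∞}
    (hC : ∀ y, ∫⁻ ω, H (X ω, y) ∂P ≤ C) : ∫⁻ ω, H (X ω, Y ω) ∂P ≤ C := by
  have h1 := (indepFun_iff_map_prod_eq_prod_map_map hX.aemeasurable hY.aemeasurable).1 h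
  have : IsProbabilityMeasure (P.map X) := Measure.isProbabilityMeasure_map hX.aemeasurable
  have : IsProbabilityMeasure (P.map Y) := Measure.isProbabilityMeasure_map hY.aemeasurable
  rw [← lintegral_map hH (hX.prodMk hY), h1, lintegral_prod_symm' _ hH]
  calc ∫⁻ y, ∫⁻ x, H (x, y) ∂(P.map X) ∂(P.map Y) ≤ ∫⁻ _, C ∂(P.map Y) := by
        refine lintegral_mono fun y => ?_
        exact (lintegral_map (f := fun x => H (x, y)) (hH.comp measurable_prodMk_right) hX).trans_le (hC y)
    _ = C := by simp

theorem eLpNorm_two_eq {f : Ω → ℝ} : eLpNorm f 2 P = (∫⁻ ω, ‖f ω‖ₑ ^ 2 ∂P) ^ (1 / 2 : ℝ) := by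
  rw [eLpNorm_eq_lintegral_rpow_enorm_toReal (by simp) (by simp)]
  simp

theorem eLpNorm_two_le_iff {f : Ω → ℝ} {C : ℝ≥0∞} :
    eLpNorm f 2 P ≤ C ↔ ∫⁻ ω, ‖f ω‖ₑ ^ 2 ∂P ≤ C ^ 2 := by
  rw [eLpNorm_two_eq, one_div, ENNReal.rpow_inv_le_iff (by norm_num)]
  norm_num

theorem eLpNorm_comp_le_of_indepFun {S S' : Type*} [MeasurableSpace S] [MeasurableSpace S']
    [IsProbabilityMeasure P] {X : Ω → S} {Y : Ω → S'} (hX : Measurable X) (hY : Measurable Y)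
    (h : IndepFun X Y P) {G : S → S' → ℝ} (hG : Measurable fun p : S × S' => G p.1 p.2) {C : ℝ≥0∞}
    (hC : ∀ y, eLpNorm (fun ω => G (X ω) y) 2 P ≤ C) :
    eLpNorm (fun ω => G (X ω) (Y ω)) 2 P ≤ C := by
  rw [eLpNorm_two_le_iff]
  exact lintegral_comp_le_of_indepFun hX hY h (H := fun p => ‖G p.1 p.2‖ₑ ^ 2)
    (hG.enorm.pow_const 2) fun y => eLpNorm_two_le_iff.1 (hC y)

/-- Freezing an independent argument. -/
theorem eLpNorm_comp_le_of_indep {S : Type*} [mS : MeasurableSpace S] [IsProbabilityMeasure P]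
    {m₁ m₂ : MeasurableSpace Ω} (h₁ : m₁ ≤ mΩ) (h₂ : m₂ ≤ mΩ) (h : Indep m₁ m₂ P)
    {G : Ω → S → ℝ} (hG : @Measurable (Ω × S) ℝ (m₁.prod mS) _ fun p => G p.1 p.2)
    {Y : Ω → S} (hY : Measurable[m₂] Y) {C : ℝ≥0∞} (hC : ∀ y, eLpNorm (fun ω => G ω y) 2 P ≤ C) :
    eLpNorm (fun ω => G ω (Y ω)) 2 P ≤ C := by
  -- The whole sample point serves as the first variable: `id` into `Ω` equipped with `m₁` generates
  -- exactly `m₁`.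
  refine @eLpNorm_comp_le_of_indepFun Ω mΩ P Ω S m₁ mS _ id Y (measurable_id'' h₁)
    (hY.mono h₂ le_rfl) ?_ G hG C hC
  refine (@IndepFun_iff_Indep Ω Ω S mΩ m₁ mS id Y P).2 ?_
  rw [MeasurableSpace.comap_id]
  exact indep_of_indep_of_le_right h hY.comap_le

end Independence

/-! ### Joint measurability in the sample and the phase space point. -/

section Measurability

variable {Ω : Type*} [MeasurableSpace Ω] {d : ℕ}

theorem measurable_uncurry_of_continuous {ψ : Ω → Phase d → Phase d}
    (hc : ∀ ω, Continuous (ψ ω)) (hm : ∀ z, Measurable fun ω => ψ ω z) :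
    Measurable fun p : Ω × Phase d => ψ p.1 p.2 := by
  have : Measurable (Function.uncurry fun z ω => ψ ω z) :=
    measurable_uncurry_of_continuous_of_measurable hc hm
  exact this.comp measurable_swap

theorem measurable_composedInverseFlow {ψ : ℕ → Ω → Phase d → Phase d} {n : ℕ}
    (hc : ∀ k < n, ∀ ω, Continuous (ψ k ω)) (hm : ∀ k < n, ∀ z, Measurable fun ω => ψ k ω z) :
    Measurable fun p : Ω × Phase d => composedInverseFlow (fun k => ψ k p.1) n p.2 := by
  induction n with
  | zero => exact measurable_snd
  | succ n ih =>
    have h1 := ih (fun k hk => hc k (by omega)) (fun k hk => hm k (by omega))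
    have h2 := measurable_uncurry_of_continuous (hc n (by omega)) (hm n (by omega))
    exact h1.comp (measurable_fst.prodMk h2)

/-- The interpolation as a sum over the offsets of the vertices. -/
theorem interpolate_eq_sum_offset (δ : Fin d ⊕ Fin d → ℝ) (g : Phase d → ℝ) (y : Phase d) :
    interpolate δ g y = ∑ s ∈ Fintype.piFinset (fun _ : Fin d ⊕ Fin d => ({0, 1} : Finset ℤ)),
      g (gridPoint δ fun i => ⌊y i / δ i⌋ + s i)
        * ∏ i, lagrangeBasis ⌊y i / δ i⌋ (⌊y i / δ i⌋ + s i) (δ i) (y i) := by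
  rw [interpolate_eq]
  symm
  refine Finset.sum_bij (fun s _ => fun i => ⌊y i / δ i⌋ + s i) ?_ ?_ ?_ ?_
  · intro s hs
    rw [mem_cellVertices]
    intro i
    have := Fintype.mem_piFinset.1 hs i
    simp only [Finset.mem_insert, Finset.mem_singleton] at this
    rcases this with h | h <;> simp [h]
  · intro s _ s' _ h
    funext i
    have := congrFun h i
    simpa using this
  · intro l hl
    refine ⟨fun i => l i - ⌊y i / δ i⌋, ?_, ?_⟩
    · rw [Fintype.mem_piFinset]
      intro i
      rcases mem_cellVertices.1 hl i with h | h <;> simp [h]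
    · funext i; simp
  · intro s _
    rfl

/-- Only countably many grid points occur, so measurability of `g` in `ω` at each fixed point is
enough. Summing over offsets makes the index set independent of `y`. -/
theorem measurable_interpolate (δ : Fin d ⊕ Fin d → ℝ) {g : Ω → Phase d → ℝ}
    (hg : ∀ z, Measurable fun ω => g ω z) :
    Measurable fun p : Ω × Phase d => interpolate δ (g p.1) p.2 := by
  simp only [interpolate_eq_sum_offset]
  have hfl : Measurable fun p : Ω × Phase d => fun i => ⌊p.2 i / δ i⌋ := by
    refine measurable_pi_lambda _ fun i => ?_
    fun_prop
  refine Finset.measurable_sum _ fun s _ => Measurable.mul ?_ ?_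
  · have h1 : Measurable fun q : Ω × (Fin d ⊕ Fin d → ℤ) => g q.1 (gridPoint δ fun i => q.2 i + s i) :=
      measurable_from_prod_countable_left fun l => hg (gridPoint δ fun i => l i + s i)
    exact h1.comp (measurable_fst.prodMk hfl)
  · refine Finset.measurable_prod _ fun i _ => ?_
    have hi : Measurable fun p : Ω × Phase d => ⌊p.2 i / δ i⌋ := by fun_prop
    have hi' : Measurable fun p : Ω × Phase d => (⌊p.2 i / δ i⌋ : ℝ) :=
      measurable_from_top.comp hi
    unfold lagrangeBasis
    simp only [add_eq_left]
    by_cases hs : s i = 0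
    · simp only [hs, if_true]
      fun_prop
    · simp only [hs, if_false]
      fun_prop

/-- The σ-algebra on `Ω` is arbitrary here: it is applied both with the ambient one and with the
algebra of the increments up to `t_n`. -/
theorem measurable_errorMajorant {f₀ : Phase d → ℝ} (hf : Continuous f₀) (δ : Fin d ⊕ Fin d → ℝ)
    (ε₀ κ : ℝ) {ψ : ℕ → Ω → Phase d → Phase d} {n : ℕ}
    (hc : ∀ k < n, ∀ ω, Continuous (ψ k ω)) (hm : ∀ k < n, ∀ z, Measurable fun ω => ψ k ω z) :
    Measurable fun p : Ω × Phase d => errorMajorant f₀ δ ε₀ κ (fun k => ψ k p.1) n p.2 := by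
  induction n with
  | zero => exact measurable_const
  | succ n ih =>
    have h1 := ih (fun k hk => hc k (by omega)) (fun k hk => hm k (by omega))
    have h2 := measurable_composedInverseFlow hc hm
    have h3 : Measurable fun p : Ω × Phase d =>
        (f₀ ∘ composedInverseFlow (fun k => ψ k p.1) (n + 1)) p.2 := hf.measurable.comp h2
    have h4 : ∀ z, Measurable fun ω =>
        (f₀ ∘ composedInverseFlow (fun k => ψ k ω) (n + 1)) z := fun z =>
      h3.comp (measurable_id.prodMk measurable_const)
    have h5 : ∀ z, Measurable fun ω =>
        (errorMajorant f₀ δ ε₀ κ (fun k => ψ k ω) n ∘ ψ n ω) z := fun z =>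
      h1.comp (measurable_id.prodMk (hm n (by omega) z))
    exact ((measurable_interpolate δ h5).add
      (((measurable_interpolate δ h4).sub h3).abs)).add measurable_const

end Measurability

/-! ### Second-order Taylor remainders along random flows. -/

section SecondOrderRemainder

/-- The variance of `b` under the uniform law on `[0, 1]` is nonnegative. -/
theorem sq_intervalIntegral_le {b : ℝ → ℝ} (hb : Continuous b) :
    (∫ t in (0 : ℝ)..1, b t) ^ 2 ≤ ∫ t in (0 : ℝ)..1, b t ^ 2 := by
  set m := ∫ t in (0 : ℝ)..1, b t with hm
  have h : 0 ≤ ∫ t in (0 : ℝ)..1, (b t - m) ^ 2 :=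
    intervalIntegral.integral_nonneg zero_le_one fun t _ => sq_nonneg _
  have e : ∀ t, (b t - m) ^ 2 = b t ^ 2 - (2 * m) * b t + m ^ 2 := fun t => by ring
  simp only [e] at h
  rw [intervalIntegral.integral_add, intervalIntegral.integral_sub,
    intervalIntegral.integral_const_mul, ← hm, intervalIntegral.integral_const] at h
  · simp only [sub_zero, one_smul] at h
    linarith
  all_goals exact Continuous.intervalIntegrable (by fun_prop) _ _

/-- Taylor's formula with integral remainder; `G + (1 - t) G'` is a primitive of `(1 - t) G''`. The
integral is kept instead of a supremum over the segment because the moments of the flow derivatives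
are bounded only point by point. -/
theorem abs_remainder_le {G G' G'' b : ℝ → ℝ} (h1 : ∀ t, HasDerivAt G (G' t) t)
    (h2 : ∀ t, HasDerivAt G' (G'' t) t) (hc : Continuous G'') (hb : Continuous b)
    (hle : ∀ t, |G'' t| ≤ b t) : |G 1 - G 0 - G' 0| ≤ ∫ t in (0 : ℝ)..1, b t := by
  have h3 : ∀ t ∈ Set.uIcc (0 : ℝ) 1,
      HasDerivAt (fun t => G t + (1 - t) * G' t) ((1 - t) * G'' t) t := by
    intro t _
    have h4 : HasDerivAt (fun t : ℝ => 1 - t) (-1) t := by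
      simpa using (hasDerivAt_id t).const_sub 1
    exact ((h1 t).add (h4.mul (h2 t))).congr_deriv (by ring)
  have h5 := intervalIntegral.integral_eq_sub_of_hasDerivAt h3
    (Continuous.intervalIntegrable (by fun_prop) _ _)
  have h6 : G 1 - G 0 - G' 0 = ∫ t in (0 : ℝ)..1, (1 - t) * G'' t := by
    rw [h5]; ring
  rw [h6]
  refine (intervalIntegral.abs_integral_le_integral_abs zero_le_one).trans ?_
  refine intervalIntegral.integral_mono_on zero_le_one
    (Continuous.intervalIntegrable (by fun_prop) _ _) (hb.intervalIntegrable _ _) ?_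
  intro t ht
  rw [abs_mul, abs_of_nonneg (by linarith [ht.2] : 0 ≤ 1 - t)]
  have := abs_nonneg (G'' t)
  have := hle t
  nlinarith [ht.1, ht.2]

theorem measurable_of_hasDerivAt {Ω E : Type*} [MeasurableSpace Ω] [NormedAddCommGroup E]
    [NormedSpace ℝ E] [MeasurableSpace E] [BorelSpace E] [SecondCountableTopology E]
    {F F' : Ω → ℝ → E}
    (hF : ∀ t, Measurable fun ω => F ω t) (h : ∀ ω t, HasDerivAt (F ω) (F' ω t) t) (t : ℝ) :
    Measurable fun ω => F' ω t := by
  refine measurable_of_tendsto_metrizable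
    (f := fun (n : ℕ) ω => ((1 : ℝ) / (n + 1))⁻¹ • (F ω (t + 1 / (n + 1)) - F ω t)) ?_ ?_
  · intro n
    exact ((hF _).sub (hF _)).const_smul _
  · rw [tendsto_pi_nhds]
    intro ω
    have h1 := (h ω t).tendsto_slope_zero
    refine h1.comp (tendsto_nhdsWithin_iff.2 ⟨tendsto_one_div_add_atTop_nhds_zero_nat, ?_⟩)
    filter_upwards with n
    simp only [Set.mem_compl_iff, Set.mem_singleton_iff]
    positivity

variable {E : Type*} [NormedAddCommGroup E] [NormedSpace ℝ E]
  {F : Type*} [NormedAddCommGroup F] [NormedSpace ℝ F]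

theorem norm_fderiv_apply_le (f : E → F) (z u : E) :
    ‖fderiv ℝ f z u‖ ≤ ‖iteratedFDeriv ℝ 1 f z‖ * ‖u‖ := by
  rw [norm_iteratedFDeriv_one]
  exact ContinuousLinearMap.le_opNorm _ _

theorem norm_fderiv_fderiv_eq (f : E → F) (z : E) :
    ‖fderiv ℝ (fderiv ℝ f) z‖ = ‖iteratedFDeriv ℝ 2 f z‖ := by
  rw [← norm_iteratedFDeriv_fderiv, norm_iteratedFDeriv_one]

theorem norm_fderiv_fderiv_apply_le (f : E → F) (z u v : E) :
    ‖fderiv ℝ (fderiv ℝ f) z u v‖ ≤ ‖iteratedFDeriv ℝ 2 f z‖ * ‖u‖ * ‖v‖ := by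
  rw [← norm_fderiv_fderiv_eq]
  exact ContinuousLinearMap.le_opNorm₂ _ _ _

theorem hasDerivAt_line {f : E → F} (hf : ContDiff ℝ 2 f) (y u : E) (t : ℝ) :
    HasDerivAt (fun t : ℝ => f (y + t • u)) (fderiv ℝ f (y + t • u) u) t := by
  have h1 : HasDerivAt (fun t : ℝ => y + t • u) u t := by
    simpa using ((hasDerivAt_id t).smul_const u).const_add y
  exact ((hf.differentiable (by norm_num)) _).hasFDerivAt.comp_hasDerivAt t h1

theorem hasDerivAt_fderiv_line {f : E → F} (hf : ContDiff ℝ 2 f) (y u : E) (t : ℝ) :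
    HasDerivAt (fun t : ℝ => fderiv ℝ f (y + t • u) u)
      (fderiv ℝ (fderiv ℝ f) (y + t • u) u u) t := by
  have h1 : HasDerivAt (fun t : ℝ => y + t • u) u t := by
    simpa using ((hasDerivAt_id t).smul_const u).const_add y
  have h2 : ContDiff ℝ 1 (fderiv ℝ f) := hf.fderiv_right (by norm_num)
  have h3 := ((h2.differentiable (by norm_num)) (y + t • u)).hasFDerivAt.comp_hasDerivAt t h1
  simpa using h3.clm_apply (hasDerivAt_const t u)

theorem continuous_fderiv_line {f : E → F} (hf : ContDiff ℝ 2 f) (y u : E) :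
    Continuous fun t : ℝ => fderiv ℝ f (y + t • u) u := by
  have := hf.continuous_fderiv (by norm_num)
  fun_prop

theorem continuous_fderiv_fderiv_line {f : E → F} (hf : ContDiff ℝ 2 f) (y u : E) :
    Continuous fun t : ℝ => fderiv ℝ (fderiv ℝ f) (y + t • u) u u := by
  have h2 : ContDiff ℝ 1 (fderiv ℝ f) := hf.fderiv_right (by norm_num)
  have := h2.continuous_fderiv (by norm_num)
  fun_prop

/-- Second-order Taylor bound for a composition along a segment. -/
theorem abs_comp_remainder_le {f : F → ℝ} {Φ : E → F} (hf : ContDiff ℝ 2 f) (hΦ : ContDiff ℝ 2 Φ)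
    {c₁ c₂ : ℝ} (h1 : ∀ z, ‖fderiv ℝ f z‖ ≤ c₁) (h2 : ∀ z, ‖iteratedFDeriv ℝ 2 f z‖ ≤ c₂) (y u : E) :
    |f (Φ (y + u)) - f (Φ y) - fderiv ℝ (f ∘ Φ) y u| ≤
      ∫ t in (0 : ℝ)..1, (c₂ * ‖fderiv ℝ Φ (y + t • u) u‖ ^ 2
        + c₁ * ‖fderiv ℝ (fderiv ℝ Φ) (y + t • u) u u‖) := by
  have hg : ContDiff ℝ 2 (f ∘ Φ) := hf.comp hΦ
  have hp := continuous_fderiv_line hΦ y u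
  have hq := continuous_fderiv_fderiv_line hΦ y u
  have key := abs_remainder_le (G := fun t : ℝ => (f ∘ Φ) (y + t • u))
    (fun t => hasDerivAt_line hg y u t) (fun t => hasDerivAt_fderiv_line hg y u t)
    (continuous_fderiv_fderiv_line hg y u)
    (b := fun t => c₂ * ‖fderiv ℝ Φ (y + t • u) u‖ ^ 2
        + c₁ * ‖fderiv ℝ (fderiv ℝ Φ) (y + t • u) u u‖) (by fun_prop) ?_
  · simpa using key
  · intro t
    have hfd : ∀ s : ℝ, fderiv ℝ (f ∘ Φ) (y + s • u) u
        = fderiv ℝ f (Φ (y + s • u)) (fderiv ℝ Φ (y + s • u) u) := by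
      intro s
      rw [fderiv_comp _ (hf.differentiable (by norm_num) _) (hΦ.differentiable (by norm_num) _)]
      rfl
    have hf1 : ContDiff ℝ 1 (fderiv ℝ f) := hf.fderiv_right (by norm_num)
    have hA : HasDerivAt (fun s : ℝ => fderiv ℝ f (Φ (y + s • u)))
        (fderiv ℝ (fderiv ℝ f) (Φ (y + t • u)) (fderiv ℝ Φ (y + t • u) u)) t :=
      ((hf1.differentiable (by norm_num)) _).hasFDerivAt.comp_hasDerivAt t
        (hasDerivAt_line hΦ y u t)
    have hB := hA.clm_apply (hasDerivAt_fderiv_line hΦ y u t)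
    have hC := hasDerivAt_fderiv_line hg y u t
    simp only [hfd] at hC
    -- The same derivative computed for `f ∘ Φ` and by the product rule: this yields the
    -- second-order chain rule along the line.
    rw [hC.unique hB]
    refine (abs_add_le _ _).trans (add_le_add ?_ ?_)
    · rw [← Real.norm_eq_abs]
      refine (norm_fderiv_fderiv_apply_le _ _ _ _).trans ?_
      rw [mul_assoc, ← sq]
      exact mul_le_mul_of_nonneg_right (h2 _) (by positivity)
    · rw [← Real.norm_eq_abs]
      refine (ContinuousLinearMap.le_opNorm _ _).trans ?_
      exact mul_le_mul_of_nonneg_right (h1 _) (by positivity)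

/-! ### `L²` bounds for the remainder and the interpolation error. -/

section Moments

variable {Ω : Type*} [MeasurableSpace Ω] {P : Measure Ω} [IsProbabilityMeasure P] {d : ℕ}
  {Φ : Ω → Phase d → Phase d} {A₄ A₂ : ℝ≥0} {c₁ c₂ : ℝ} {f : Phase d → ℝ}

/-- The second derivative of `f ∘ Φ` is at most `c₂‖DΦ‖² + c₁‖D²Φ‖`. Squaring under the integral and
exchanging it with the expectation leaves moments at deterministic points of the segment: the fourth
of `DΦ` and the second of `D²Φ`. -/
theorem eLpNorm_comp_remainder_le (hΦ : ∀ ω, ContDiff ℝ 2 (Φ ω)) (hm : ∀ z, Measurable fun ω => Φ ω z)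
    (hA₄ : ∀ z, ∫⁻ ω, ‖iteratedFDeriv ℝ 1 (Φ ω) z‖ₑ ^ (4 : ℝ) ∂P ≤ A₄)
    (hA₂ : ∀ z, ∫⁻ ω, ‖iteratedFDeriv ℝ 2 (Φ ω) z‖ₑ ^ (2 : ℝ) ∂P ≤ A₂)
    (hf : ContDiff ℝ 2 f) (h1 : ∀ z, ‖fderiv ℝ f z‖ ≤ c₁) (h2 : ∀ z, ‖iteratedFDeriv ℝ 2 f z‖ ≤ c₂)
    (y u : Phase d) :
    eLpNorm (fun ω => f (Φ ω (y + u)) - f (Φ ω y) - fderiv ℝ (f ∘ Φ ω) y u) 2 P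
      ≤ ENNReal.ofReal (√(2 * c₂ ^ 2 * A₄ + 2 * c₁ ^ 2 * A₂) * ‖u‖ ^ 2) := by
  set p : Ω → ℝ → Phase d := fun ω t => fderiv ℝ (Φ ω) (y + t • u) u with hp
  set q : Ω → ℝ → Phase d := fun ω t => fderiv ℝ (fderiv ℝ (Φ ω)) (y + t • u) u u with hq
  have hpc : ∀ ω, Continuous (p ω) := fun ω => continuous_fderiv_line (hΦ ω) y u
  have hqc : ∀ ω, Continuous (q ω) := fun ω => continuous_fderiv_fderiv_line (hΦ ω) y u
  have hpm : ∀ t, Measurable fun ω => p ω t := fun t =>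
    measurable_of_hasDerivAt (F := fun ω t => Φ ω (y + t • u)) (fun t => hm _)
      (fun ω t => hasDerivAt_line (hΦ ω) y u t) t
  have hqm : ∀ t, Measurable fun ω => q ω t := fun t =>
    measurable_of_hasDerivAt (F := p) hpm (fun ω t => hasDerivAt_fderiv_line (hΦ ω) y u t) t
  have hpj : Measurable fun z : Ω × ℝ => p z.1 z.2 :=
    (measurable_uncurry_of_continuous_of_measurable (u := fun t ω => p ω t) hpc hpm).comp
      measurable_swap
  have hqj : Measurable fun z : Ω × ℝ => q z.1 z.2 :=
    (measurable_uncurry_of_continuous_of_measurable (u := fun t ω => q ω t) hqc hqm).comp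
      measurable_swap
  set H : Ω → ℝ → ℝ≥0∞ := fun ω t =>
    ENNReal.ofReal (2 * c₂ ^ 2) * ‖p ω t‖ₑ ^ 4 + ENNReal.ofReal (2 * c₁ ^ 2) * ‖q ω t‖ₑ ^ 2 with hH
  have hHm : Measurable (Function.uncurry H) :=
    ((hpj.enorm.pow_const 4).const_mul _).add ((hqj.enorm.pow_const 2).const_mul _)
  -- pathwise bound
  have hpath : ∀ ω, ‖f (Φ ω (y + u)) - f (Φ ω y) - fderiv ℝ (f ∘ Φ ω) y u‖ₑ ^ 2
      ≤ ∫⁻ t in Set.Ioc (0 : ℝ) 1, H ω t := by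
    intro ω
    have hpω := hpc ω
    have hqω := hqc ω
    have e1 := abs_comp_remainder_le hf (hΦ ω) h1 h2 y u
    set b : ℝ → ℝ := fun t => c₂ * ‖p ω t‖ ^ 2 + c₁ * ‖q ω t‖ with hb
    have hbc : Continuous b := by fun_prop
    have e2 := sq_intervalIntegral_le hbc
    have e3 : ∫ t in (0 : ℝ)..1, b t ^ 2
        ≤ ∫ t in (0 : ℝ)..1, (2 * c₂ ^ 2 * ‖p ω t‖ ^ 4 + 2 * c₁ ^ 2 * ‖q ω t‖ ^ 2) := by
      refine intervalIntegral.integral_mono_on zero_le_one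
        (Continuous.intervalIntegrable (by fun_prop) _ _)
        (Continuous.intervalIntegrable (by fun_prop) _ _) fun t _ => ?_
      have : 0 ≤ (c₂ * ‖p ω t‖ ^ 2 - c₁ * ‖q ω t‖) ^ 2 := sq_nonneg _
      simp only [hb]
      nlinarith
    rw [← ofReal_norm, ← ENNReal.ofReal_pow (norm_nonneg _), Real.norm_eq_abs]
    calc ENNReal.ofReal (|f (Φ ω (y + u)) - f (Φ ω y) - fderiv ℝ (f ∘ Φ ω) y u| ^ 2)
        ≤ ENNReal.ofReal
          (∫ t in (0 : ℝ)..1, (2 * c₂ ^ 2 * ‖p ω t‖ ^ 4 + 2 * c₁ ^ 2 * ‖q ω t‖ ^ 2)) := by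
          refine ENNReal.ofReal_le_ofReal (le_trans ?_ (e2.trans e3))
          exact pow_le_pow_left₀ (abs_nonneg _) e1 2
      _ = ∫⁻ t in Set.Ioc (0 : ℝ) 1,
          ENNReal.ofReal (2 * c₂ ^ 2 * ‖p ω t‖ ^ 4 + 2 * c₁ ^ 2 * ‖q ω t‖ ^ 2) := by
          rw [intervalIntegral.integral_of_le zero_le_one, ofReal_integral_eq_lintegral_ofReal]
          · exact (Continuous.integrableOn_Icc (by fun_prop)).mono_set Set.Ioc_subset_Icc_self
          · exact ae_of_all _ fun t => by positivity
      _ = ∫⁻ t in Set.Ioc (0 : ℝ) 1, H ω t := by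
          refine lintegral_congr fun t => ?_
          rw [ENNReal.ofReal_add (by positivity) (by positivity),
            ENNReal.ofReal_mul (p := 2 * c₂ ^ 2) (by positivity),
            ENNReal.ofReal_mul (p := 2 * c₁ ^ 2) (by positivity),
            ENNReal.ofReal_pow (norm_nonneg _), ENNReal.ofReal_pow (norm_nonneg _),
            ofReal_norm, ofReal_norm]
  -- moments
  have hmom : ∀ t, ∫⁻ ω, H ω t ∂P
      ≤ (ENNReal.ofReal (2 * c₂ ^ 2) * A₄ + ENNReal.ofReal (2 * c₁ ^ 2) * A₂) * ‖u‖ₑ ^ 4 := by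
    intro t
    have hu : ‖u‖ₑ ^ 4 ≠ ∞ := by simp
    have h4 : ∫⁻ ω, ‖p ω t‖ₑ ^ 4 ∂P ≤ A₄ * ‖u‖ₑ ^ 4 := by
      calc ∫⁻ ω, ‖p ω t‖ₑ ^ 4 ∂P
          ≤ ∫⁻ ω, ‖iteratedFDeriv ℝ 1 (Φ ω) (y + t • u)‖ₑ ^ (4 : ℝ) * ‖u‖ₑ ^ 4 ∂P := by
            refine lintegral_mono fun ω => ?_
            have : ‖p ω t‖ₑ ≤ ‖iteratedFDeriv ℝ 1 (Φ ω) (y + t • u)‖ₑ * ‖u‖ₑ := by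
              simp only [← ofReal_norm]
              rw [← ENNReal.ofReal_mul (norm_nonneg _)]
              exact ENNReal.ofReal_le_ofReal (norm_fderiv_apply_le _ _ _)
            calc ‖p ω t‖ₑ ^ 4 ≤ (‖iteratedFDeriv ℝ 1 (Φ ω) (y + t • u)‖ₑ * ‖u‖ₑ) ^ 4 := by gcongr
              _ = _ := by rw [mul_pow]; norm_cast
        _ ≤ A₄ * ‖u‖ₑ ^ 4 := by
            rw [lintegral_mul_const' _ _ hu]
            gcongr
            exact hA₄ _
    have h2' : ∫⁻ ω, ‖q ω t‖ₑ ^ 2 ∂P ≤ A₂ * ‖u‖ₑ ^ 4 := by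
      calc ∫⁻ ω, ‖q ω t‖ₑ ^ 2 ∂P
          ≤ ∫⁻ ω, ‖iteratedFDeriv ℝ 2 (Φ ω) (y + t • u)‖ₑ ^ (2 : ℝ) * ‖u‖ₑ ^ 4 ∂P := by
            refine lintegral_mono fun ω => ?_
            have : ‖q ω t‖ₑ ≤ ‖iteratedFDeriv ℝ 2 (Φ ω) (y + t • u)‖ₑ * ‖u‖ₑ ^ 2 := by
              simp only [← ofReal_norm]
              rw [← ENNReal.ofReal_pow (norm_nonneg _), ← ENNReal.ofReal_mul (norm_nonneg _)]
              refine ENNReal.ofReal_le_ofReal ((norm_fderiv_fderiv_apply_le _ _ _ _).trans_eq ?_)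
              ring
            calc ‖q ω t‖ₑ ^ 2 ≤ (‖iteratedFDeriv ℝ 2 (Φ ω) (y + t • u)‖ₑ * ‖u‖ₑ ^ 2) ^ 2 := by
                  gcongr
              _ = _ := by rw [mul_pow, ← pow_mul]; norm_cast
        _ ≤ A₂ * ‖u‖ₑ ^ 4 := by
            rw [lintegral_mul_const' _ _ hu]
            gcongr
            exact hA₂ _
    simp only [hH]
    rw [lintegral_add_left (((hpm t).enorm.pow_const 4).const_mul _),
      lintegral_const_mul' _ _ ENNReal.ofReal_ne_top, lintegral_const_mul' _ _ ENNReal.ofReal_ne_top,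
      add_mul, mul_assoc, mul_assoc]
    gcongr
  rw [eLpNorm_two_le_iff]
  calc ∫⁻ ω, ‖f (Φ ω (y + u)) - f (Φ ω y) - fderiv ℝ (f ∘ Φ ω) y u‖ₑ ^ 2 ∂P
      ≤ ∫⁻ ω, (∫⁻ t in Set.Ioc (0 : ℝ) 1, H ω t) ∂P := lintegral_mono hpath
    _ = ∫⁻ t in Set.Ioc (0 : ℝ) 1, (∫⁻ ω, H ω t ∂P) := lintegral_lintegral_swap hHm.aemeasurable
    _ ≤ ∫⁻ _ in Set.Ioc (0 : ℝ) 1,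
        (ENNReal.ofReal (2 * c₂ ^ 2) * A₄ + ENNReal.ofReal (2 * c₁ ^ 2) * A₂) * ‖u‖ₑ ^ 4 :=
        lintegral_mono hmom
    _ = (ENNReal.ofReal (2 * c₂ ^ 2) * A₄ + ENNReal.ofReal (2 * c₁ ^ 2) * A₂) * ‖u‖ₑ ^ 4 := by
        simp
    _ = ENNReal.ofReal (√(2 * c₂ ^ 2 * A₄ + 2 * c₁ ^ 2 * A₂) * ‖u‖ ^ 2) ^ 2 := by
        rw [← ENNReal.ofReal_pow (by positivity), mul_pow, Real.sq_sqrt (by positivity), ← pow_mul,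
          ENNReal.ofReal_mul (p := 2 * c₂ ^ 2 * A₄ + 2 * c₁ ^ 2 * A₂) (by positivity),
          ENNReal.ofReal_add (by positivity) (by positivity),
          ENNReal.ofReal_mul (p := 2 * c₂ ^ 2) (by positivity), ENNReal.ofReal_mul (p := 2 * c₁ ^ 2) (by positivity),
          ENNReal.ofReal_pow (norm_nonneg _), ofReal_norm]
        simp

/-- The weights sum to one and reproduce the coordinates, so the linear Taylor terms cancel. What
remains is a convex combination of remainders with displacement of squared length at most `2d h²`.
-/
theorem eLpNorm_interpolation_error_le {δ : Fin d ⊕ Fin d → ℝ} (hδ : ∀ i, 0 < δ i)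
    (hΦ : ∀ ω, ContDiff ℝ 2 (Φ ω)) (hm : ∀ z, Measurable fun ω => Φ ω z)
    (hA₄ : ∀ z, ∫⁻ ω, ‖iteratedFDeriv ℝ 1 (Φ ω) z‖ₑ ^ (4 : ℝ) ∂P ≤ A₄)
    (hA₂ : ∀ z, ∫⁻ ω, ‖iteratedFDeriv ℝ 2 (Φ ω) z‖ₑ ^ (2 : ℝ) ∂P ≤ A₂)
    (hf : ContDiff ℝ 2 f) (h1 : ∀ z, ‖fderiv ℝ f z‖ ≤ c₁) (h2 : ∀ z, ‖iteratedFDeriv ℝ 2 f z‖ ≤ c₂)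
    (y : Phase d) :
    eLpNorm (fun ω => interpolate δ (f ∘ Φ ω) y - (f ∘ Φ ω) y) 2 P
      ≤ ENNReal.ofReal (√(2 * c₂ ^ 2 * A₄ + 2 * c₁ ^ 2 * A₂) * (2 * d * ‖δ‖ ^ 2)) := by
  set M := √(2 * c₂ ^ 2 * A₄ + 2 * c₁ ^ 2 * A₂) with hM
  set X : (Fin d ⊕ Fin d → ℤ) → Ω → ℝ := fun l ω =>
    f (Φ ω (y + (gridPoint δ l - y))) - f (Φ ω y) - fderiv ℝ (f ∘ Φ ω) y (gridPoint δ l - y) with hX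
  have hdm : ∀ u, Measurable fun ω => fderiv ℝ (f ∘ Φ ω) y u := by
    intro u
    have := measurable_of_hasDerivAt (F := fun ω (t : ℝ) => (f ∘ Φ ω) (y + t • u))
      (fun t => hf.continuous.measurable.comp (hm _))
      (fun ω t => hasDerivAt_line (hf.comp (hΦ ω)) y u t) 0
    simpa using this
  have hXm : ∀ l, Measurable (X l) := fun l =>
    ((hf.continuous.measurable.comp (hm _)).sub (hf.continuous.measurable.comp (hm _))).sub (hdm _)
  have e : (fun ω => interpolate δ (f ∘ Φ ω) y - (f ∘ Φ ω) y)
      = ∑ l ∈ cellVertices δ y, vertexWeight δ y l • X l := by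
    funext ω
    have e0 : ∑ l ∈ cellVertices δ y,
        vertexWeight δ y l * fderiv ℝ (f ∘ Φ ω) y (gridPoint δ l - y) = 0 := by
      have := congrArg (fderiv ℝ (f ∘ Φ ω) y) (sum_vertexWeight_smul_sub (y := y) hδ)
      simpa [map_sum] using this
    rw [Finset.sum_apply, interpolate_eq]
    simp only [hX, Pi.smul_apply, smul_eq_mul, mul_sub, Finset.sum_sub_distrib, e0, sub_zero,
      ← Finset.sum_mul, sum_vertexWeight hδ, one_mul, add_sub_cancel, Function.comp_apply]
    congr 1
    exact Finset.sum_congr rfl fun l _ => mul_comm _ _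
  rw [e]
  refine (eLpNorm_sum_le (fun l _ => ((hXm l).const_smul _).aestronglyMeasurable)
    (by norm_num)).trans ?_
  calc ∑ l ∈ cellVertices δ y, eLpNorm (vertexWeight δ y l • X l) 2 P
      ≤ ∑ l ∈ cellVertices δ y,
        ENNReal.ofReal (vertexWeight δ y l) * ENNReal.ofReal (M * (2 * d * ‖δ‖ ^ 2)) := by
        refine Finset.sum_le_sum fun l hl => ?_
        rw [eLpNorm_const_smul, ← ofReal_norm, Real.norm_eq_abs,
          abs_of_nonneg (vertexWeight_nonneg hδ)]
        gcongr
        refine (eLpNorm_comp_remainder_le hΦ hm hA₄ hA₂ hf h1 h2 y _).trans ?_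
        gcongr
        exact norm_gridPoint_sub_sq_le hδ hl
    _ = ENNReal.ofReal (M * (2 * d * ‖δ‖ ^ 2)) := by
        rw [← Finset.sum_mul, ← ENNReal.ofReal_sum_of_nonneg
          (fun l _ => vertexWeight_nonneg hδ), sum_vertexWeight hδ, ENNReal.ofReal_one, one_mul]

end Moments

end SecondOrderRemainder

/-! ### Interpolation error of the initial density, the source of `κ`. -/

section DeterministicRemainder

variable {d : ℕ} {c₂ : ℝ} {f : Phase d → ℝ}

theorem abs_interpolation_error_le {δ : Fin d ⊕ Fin d → ℝ} (hδ : ∀ i, 0 < δ i)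
    (hf : ContDiff ℝ 2 f) (h2 : ∀ z, ‖iteratedFDeriv ℝ 2 f z‖ ≤ c₂) (y : Phase d) :
    |interpolate δ f y - f y| ≤ c₂ * (2 * d * ‖δ‖ ^ 2) := by
  have hc₂ : 0 ≤ c₂ := (norm_nonneg _).trans (h2 0)
  have hX : ∀ u, |f (y + u) - f y - fderiv ℝ f y u| ≤ c₂ * ‖u‖ ^ 2 := by
    intro u
    have := abs_remainder_le (G := fun t : ℝ => f (y + t • u)) (b := fun _ => c₂ * ‖u‖ ^ 2)
      (fun t => hasDerivAt_line hf y u t) (fun t => hasDerivAt_fderiv_line hf y u t)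
      (continuous_fderiv_fderiv_line hf y u) continuous_const ?_
    · simpa using this
    · intro t
      rw [← Real.norm_eq_abs]
      refine (norm_fderiv_fderiv_apply_le _ _ _ _).trans ?_
      rw [mul_assoc, ← sq]
      exact mul_le_mul_of_nonneg_right (h2 _) (by positivity)
  have e : interpolate δ f y - f y = ∑ l ∈ cellVertices δ y, vertexWeight δ y l *
      (f (y + (gridPoint δ l - y)) - f y - fderiv ℝ f y (gridPoint δ l - y)) := by
    have e0 : ∑ l ∈ cellVertices δ y,
        vertexWeight δ y l * fderiv ℝ f y (gridPoint δ l - y) = 0 := by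
      have := congrArg (fderiv ℝ f y) (sum_vertexWeight_smul_sub (y := y) hδ)
      simpa [map_sum] using this
    rw [interpolate_eq]
    simp only [mul_sub, Finset.sum_sub_distrib, e0, sub_zero,
      ← Finset.sum_mul, sum_vertexWeight hδ, one_mul, add_sub_cancel]
    congr 1
    exact Finset.sum_congr rfl fun l _ => mul_comm _ _
  rw [e]
  refine (Finset.abs_sum_le_sum_abs _ _).trans ?_
  calc ∑ l ∈ cellVertices δ y, |vertexWeight δ y l *
      (f (y + (gridPoint δ l - y)) - f y - fderiv ℝ f y (gridPoint δ l - y))|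
      ≤ ∑ l ∈ cellVertices δ y, vertexWeight δ y l * (c₂ * (2 * d * ‖δ‖ ^ 2)) := by
        refine Finset.sum_le_sum fun l hl => ?_
        rw [abs_mul, abs_of_nonneg (vertexWeight_nonneg hδ)]
        refine mul_le_mul_of_nonneg_left ((hX _).trans ?_) (vertexWeight_nonneg hδ)
        exact mul_le_mul_of_nonneg_left (norm_gridPoint_sub_sq_le hδ hl) hc₂
    _ = c₂ * (2 * d * ‖δ‖ ^ 2) := by rw [← Finset.sum_mul, sum_vertexWeight hδ, one_mul]

end DeterministicRemainder

/-! ### Lifts of torus maps, and lattice compatibility of inverses. -/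

section TorusMaps

variable {d : ℕ} {L : ℝ}

/-- The translation vector `(L m, 0)`. -/
noncomputable def latticeShift (L : ℝ) (m : Fin d → ℤ) : Phase d :=
  WithLp.toLp 2 (Sum.elim (fun i => (m i : ℝ) * L) fun _ => 0)

@[simp] theorem latticeShift_inl (m : Fin d → ℤ) (i : Fin d) :
    latticeShift L m (Sum.inl i) = m i * L := rfl

@[simp] theorem latticeShift_inr (m : Fin d → ℤ) (i : Fin d) :
    latticeShift L m (Sum.inr i) = 0 := rfl

theorem Phase.ext_iff_coord {z w : Phase d} :
    z = w ↔ (∀ i, z (Sum.inl i) = w (Sum.inl i)) ∧ ∀ i, z (Sum.inr i) = w (Sum.inr i) := by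
  constructor
  · rintro rfl; exact ⟨fun _ => rfl, fun _ => rfl⟩
  · rintro ⟨h1, h2⟩
    ext (i | i)
    · exact h1 i
    · exact h2 i

theorem latticeShift_add (m k : Fin d → ℤ) :
    latticeShift L (m + k) = latticeShift L m + latticeShift L k := by
  rw [Phase.ext_iff_coord]
  constructor <;> intro i <;> simp [add_mul]

theorem latticeShift_zero : latticeShift L (0 : Fin d → ℤ) = 0 := by
  rw [Phase.ext_iff_coord]
  constructor <;> intro i <;> simp

theorem latticeShift_neg (m : Fin d → ℤ) : latticeShift L (-m) = -latticeShift L m := by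
  rw [Phase.ext_iff_coord]
  constructor <;> intro i <;> simp

theorem latticeShift_injective (hL : 0 < L) : Function.Injective (latticeShift (d := d) L) := by
  intro m k h
  funext i
  have := (Phase.ext_iff_coord.1 h).1 i
  simp only [latticeShift_inl, mul_eq_mul_right_iff, hL.ne', or_false] at this
  exact_mod_cast this

theorem latticeEquiv_iff {z w : Phase d} :
    Phase.LatticeEquiv L z w ↔ ∃ m, w = z + latticeShift L m := by
  constructor
  · rintro ⟨h1, h2⟩
    choose m hm using h1
    refine ⟨m, Phase.ext_iff_coord.2 ⟨fun i => ?_, fun i => ?_⟩⟩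
    · simp [hm i]
    · simp [h2 i]
  · rintro ⟨m, rfl⟩
    exact ⟨fun i => ⟨m i, by simp⟩, fun i => by simp⟩

theorem isTorusMap_iff {G : Phase d → Phase d} :
    Phase.IsTorusMap L G ↔ ∀ z m, ∃ k, G (z + latticeShift L m) = G z + latticeShift L k := by
  constructor
  · intro h z m
    exact latticeEquiv_iff.1 (h _ _ (latticeEquiv_iff.2 ⟨m, rfl⟩))
  · intro h z w hzw
    obtain ⟨m, rfl⟩ := latticeEquiv_iff.1 hzw
    exact latticeEquiv_iff.2 (h z m)

theorem eq_of_continuous_of_int {X : Type*} [TopologicalSpace X] [PreconnectedSpace X] {h : X → ℝ}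
    (hc : Continuous h) (hi : ∀ x, ∃ n : ℤ, h x = n) (x y : X) : h x = h y := by
  choose n hn using hi
  have : Continuous n := by
    rw [Int.isClosedEmbedding_coe_real.isEmbedding.continuous_iff]
    exact hc.congr hn
  rw [hn, hn, PreconnectedSpace.constant inferInstance this]

/-- A continuous lattice-valued difference on a connected space is constant. It is used with phase
space as parameter space for the numerical maps, and with the time interval for the exact flow. -/
theorem sub_eq_sub_of_continuous_of_latticeShift (hL : 0 < L) {X : Type*} [TopologicalSpace X]
    [PreconnectedSpace X] {u u' : X → Phase d} (hu : Continuous u) (hu' : Continuous u')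
    (h : ∀ x, ∃ k, u' x = u x + latticeShift L k) (x y : X) : u' x - u x = u' y - u y := by
  choose k hk using h
  have hsub : ∀ x, u' x - u x = latticeShift L (k x) := fun x => by rw [hk, add_sub_cancel_left]
  rw [Phase.ext_iff_coord]
  refine ⟨fun i => ?_, fun i => by simp [hsub]⟩
  have hc : Continuous fun x => (u' x - u x) (Sum.inl i) / L :=
    ((EuclideanSpace.proj (𝕜 := ℝ) (Sum.inl i : Fin d ⊕ Fin d)).continuous.comp
      (hu'.sub hu)).div_const L
  have := eq_of_continuous_of_int hc (fun x => ⟨k x i, by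
    rw [hsub, latticeShift_inl, mul_div_cancel_right₀ _ hL.ne']⟩) x y
  exact (div_left_inj' hL.ne').1 this

theorem Phase.IsTorusMap.exists_shift (hL : 0 < L) {G : Phase d → Phase d} (hG : Phase.IsTorusMap L G)
    (hc : Continuous G) (m : Fin d → ℤ) :
    ∃ k, ∀ z, G (z + latticeShift L m) = G z + latticeShift L k := by
  rw [isTorusMap_iff] at hG
  obtain ⟨k, hk⟩ := hG 0 m
  refine ⟨k, fun z => ?_⟩
  have := sub_eq_sub_of_continuous_of_latticeShift hL hc
    (hc.comp (continuous_id.add continuous_const)) (fun z => hG z m) z 0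
  rw [← sub_eq_iff_eq_add']
  refine this.trans ?_
  change G (0 + latticeShift L m) - G 0 = _
  rw [hk, add_sub_cancel_left]

/-- The part of the fundamental cell with velocities in a box. -/
def boxCell (d : ℕ) (L U : ℝ) : Set (Phase d) := Phase.fundamentalCell d L ∩ Phase.velBox d U

theorem boxCell_eq {U : ℝ} (hU : 0 ≤ U) : boxCell d L U = (WithLp.ofLp : Phase d → _) ⁻¹'
    (Set.univ.pi fun i : Fin d ⊕ Fin d =>
      Sum.elim (fun _ => Set.Ico 0 L) (fun _ => Set.Icc (-U) U) i) := by
  ext z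
  simp only [boxCell, Phase.fundamentalCell, Phase.velBox, Set.mem_inter_iff, Set.mem_ofPred_eq,
    Set.mem_preimage, Set.mem_univ_pi, Sum.forall, Sum.elim_inl, Sum.elim_inr,
    Phase.velSup_le_iff hU, abs_le, Set.mem_Icc]

theorem measurableSet_pi_box (U : ℝ) : MeasurableSet (Set.univ.pi fun i : Fin d ⊕ Fin d =>
      Sum.elim (fun _ => Set.Ico 0 L) (fun _ => Set.Icc (-U) U) i) := by
  refine MeasurableSet.univ_pi fun i => ?_
  rcases i with i | i
  · exact measurableSet_Ico
  · exact measurableSet_Icc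

theorem measurableSet_boxCell {U : ℝ} (hU : 0 ≤ U) : MeasurableSet (boxCell d L U) := by
  rw [boxCell_eq hU]
  exact (PiLp.volume_preserving_ofLp (Fin d ⊕ Fin d)).measurable (measurableSet_pi_box U)

theorem volume_boxCell {U : ℝ} (hL : 0 < L) (hU : 0 ≤ U) :
    volume (boxCell d L U) = ENNReal.ofReal (L ^ d * (2 * U) ^ d) := by
  rw [boxCell_eq hU, (PiLp.volume_preserving_ofLp (Fin d ⊕ Fin d)).measure_preimage
    (measurableSet_pi_box U).nullMeasurableSet, volume_pi_pi, Fintype.prod_sum_type]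
  simp only [Sum.elim_inl, Sum.elim_inr, Real.volume_Ico, Real.volume_Icc, Finset.prod_const,
    Finset.card_univ, Fintype.card_fin, sub_zero, sub_neg_eq_add]
  rw [ENNReal.ofReal_mul (by positivity), ENNReal.ofReal_pow hL.le, ← two_mul,
    ENNReal.ofReal_pow (by positivity)]

theorem velSup_add_latticeShift (z : Phase d) (m : Fin d → ℤ) :
    (z + latticeShift L m).velSup = z.velSup := by
  simp [Phase.velSup]

theorem exists_sub_latticeShift_mem (hL : 0 < L) (z : Phase d) :
    ∃ m, z - latticeShift L m ∈ Phase.fundamentalCell d L := by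
  refine ⟨fun i => ⌊z (Sum.inl i) / L⌋, fun i => ?_⟩
  have h1 := Int.floor_le (z (Sum.inl i) / L)
  have h2 := Int.lt_floor_add_one (z (Sum.inl i) / L)
  rw [le_div_iff₀ hL] at h1
  rw [div_lt_iff₀ hL] at h2
  simp only [PiLp.sub_apply, latticeShift_inl, Set.mem_Ico]
  constructor <;> linarith

theorem latticeShift_eq_zero_of_mem (hL : 0 < L) {z w : Phase d} {m : Fin d → ℤ}
    (hz : z ∈ Phase.fundamentalCell d L) (hw : w ∈ Phase.fundamentalCell d L)
    (h : z = w + latticeShift L m) : m = 0 := by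
  funext i
  have h1 := hz i
  have h2 := hw i
  rw [h] at h1
  simp only [PiLp.add_apply, latticeShift_inl, Set.mem_Ico] at h1 h2
  have h3 : (m i : ℝ) < 1 := by
    by_contra! h; nlinarith
  have h4 : (-1 : ℝ) < m i := by
    by_contra! h; nlinarith
  have h3' : m i < 1 := by exact_mod_cast h3
  have h4' : -1 < m i := by exact_mod_cast h4
  simp only [Pi.zero_apply]
  omega

/-- A set of bounded velocities whose lattice translates are disjoint is not larger than the
fundamental cell. -/
theorem volume_le_of_disjoint_translates (hL : 0 < L) {t : Set (Phase d)} (ht : MeasurableSet t)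
    {U : ℝ} (hU : 0 ≤ U) (hsub : t ⊆ Phase.velBox d U)
    (hdisj : ∀ a ∈ t, ∀ b ∈ t, ∀ m, a = b + latticeShift L m → m = 0) :
    volume t ≤ volume (boxCell d L U) := by
  have hW := measurableSet_boxCell (d := d) (L := L) hU
  -- The pieces of `t` moved into the cell. A point common to two of them would give two
  -- lattice-equivalent points of `t`, so they are disjoint and their volumes add up.
  set T : (Fin d → ℤ) → Set (Phase d) := fun m =>
    (fun z => z + latticeShift L m) ⁻¹' t ∩ boxCell d L U with hT
  have hmeas : ∀ m, MeasurableSet (T m) := fun m =>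
    ((measurable_id.add_const _) ht).inter hW
  have hcov : t ⊆ ⋃ m, (fun z => z + -latticeShift L m) ⁻¹' T m := by
    intro z hz
    obtain ⟨m, hm⟩ := exists_sub_latticeShift_mem hL z
    refine Set.mem_iUnion.2 ⟨m, ?_, ?_, ?_⟩
    · simpa using hz
    · simpa [sub_eq_add_neg] using hm
    · change (z + -latticeShift L m).velSup ≤ U
      rw [← latticeShift_neg, velSup_add_latticeShift]
      exact hsub hz
  calc volume t ≤ volume (⋃ m, (fun z => z + -latticeShift L m) ⁻¹' T m) := measure_mono hcov
    _ ≤ ∑' m, volume ((fun z => z + -latticeShift L m) ⁻¹' T m) := measure_iUnion_le _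
    _ = ∑' m, volume (T m) := by simp only [measure_preimage_add_right]
    _ = volume (⋃ m, T m) := by
        refine (measure_iUnion ?_ hmeas).symm
        intro m k hmk
        refine Set.disjoint_left.2 fun z hz1 hz2 => hmk ?_
        have := hdisj _ hz1.1 _ hz2.1 (m - k) (by
          rw [add_assoc, ← latticeShift_add]; simp)
        exact sub_eq_zero.1 this
    _ ≤ volume (boxCell d L U) := measure_mono (Set.iUnion_subset fun m => Set.inter_subset_right)

/-- The ratio `(1 + c/U)^d` tends to `1`: for large boxes a bounded velocity displacement cannot
absorb a factor two in volume. -/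
theorem exists_box_lt_two_mul (d : ℕ) (hL : 0 < L) (c : ℝ) :
    ∃ U : ℝ, 0 ≤ U ∧ L ^ d * (2 * (U + c)) ^ d < 2 * (L ^ d * (2 * U) ^ d) := by
  have h : Tendsto (fun U : ℝ => (1 + c / U) ^ d) atTop (𝓝 ((1 + 0) ^ d)) :=
    ((tendsto_const_nhds.div_atTop tendsto_id).const_add 1).pow d
  have h2 : (1 + 0 : ℝ) ^ d < 2 := by simp
  obtain ⟨U, hU, hU0⟩ := ((h.eventually (gt_mem_nhds h2)).and (eventually_gt_atTop 0)).exists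
  refine ⟨U, hU0.le, ?_⟩
  have e : L ^ d * (2 * (U + c)) ^ d = (1 + c / U) ^ d * (L ^ d * (2 * U) ^ d) := by
    have : 2 * (U + c) = (1 + c / U) * (2 * U) := by field_simp
    rw [this, mul_pow]; ring
  rw [e]
  have : 0 < L ^ d * (2 * U) ^ d := by positivity
  exact mul_lt_mul_of_pos_right hU this

/-- The inverse of a volume preserving torus map that moves velocities by a bounded amount
is a torus map. -/
theorem Phase.IsTorusMap.inverse (hL : 0 < L) {G Ginv : Phase d → Phase d}
    (hG : Phase.IsTorusMap L G) (hleft : Function.LeftInverse Ginv G)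
    (hright : Function.RightInverse Ginv G) (hdiff : Differentiable ℝ G)
    (hdet : ∀ z, (fderiv ℝ G z).det = 1) {c : ℝ} (hc : ∀ z, ‖((Ginv z).vel - z.vel).ofLp‖ ≤ c) :
    Phase.IsTorusMap L Ginv := by
  choose α hα using fun m => hG.exists_shift hL hdiff.continuous m
  -- Here `G(z + Lm) = G(z) + Lα(m)`. A priori `G` could be a nontrivial covering of the torus, and
  -- `Ginv` is a torus map once `α` is onto.
  suffices hsurj : ∀ v, ∃ m, α m = v by
    rw [isTorusMap_iff]
    intro w v
    obtain ⟨m, rfl⟩ := hsurj v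
    refine ⟨m, ?_⟩
    conv_lhs => rw [← hright w, ← hα, hleft]
  by_contra! hv
  obtain ⟨v, hv⟩ := hv
  have hα0 : α 0 = 0 := by
    have := hα 0 0
    rw [latticeShift_zero, add_zero, left_eq_add, ← latticeShift_zero] at this
    exact latticeShift_injective hL this
  have hv0 : v ≠ 0 := fun h => hv 0 (hα0.trans h.symm)
  have hαneg : ∀ m, α (-m) = -α m := by
    intro m
    have h1 := hα m (latticeShift L (-m))
    have h2 := hα (-m) 0
    rw [← latticeShift_add, neg_add_cancel, latticeShift_zero] at h1
    rw [zero_add] at h2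
    rw [h2, add_assoc, ← latticeShift_add, left_eq_add, ← latticeShift_zero] at h1
    exact eq_neg_of_add_eq_zero_left (latticeShift_injective hL h1)
  have hαinj : ∀ m, α m = 0 → m = 0 := by
    intro m hm
    have := hα m 0
    rw [hm, latticeShift_zero, add_zero, zero_add] at this
    have := hleft.injective this
    rw [← latticeShift_zero] at this
    exact latticeShift_injective hL this
  have hc0 : 0 ≤ c := (norm_nonneg _).trans (hc 0)
  obtain ⟨U, hU, hlt⟩ := exists_box_lt_two_mul d hL c
  have hS := measurableSet_boxCell (d := d) (L := L) hU
  set S := boxCell d L U with hSdef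
  -- If `v` is missed by `α`, take the cell together with its translate by `Lv`. Its preimage under
  -- `G` still has volume `2|S|`, yet contains no two distinct lattice-equivalent points, since
  -- these would force `α m = v` or `α (-m) = v`. So it fits into the cell with velocities up to `U
  -- + c`, which has volume below `2|S|`.
  set S' : Set (Phase d) := (fun z => z + -latticeShift L v) ⁻¹' S with hS'def
  have hS' : MeasurableSet S' := (measurable_id.add_const _) hS
  set A := S ∪ S' with hA
  have hAm : MeasurableSet A := hS.union hS'
  have hmemA : ∀ a ∈ A, ∃ s ∈ S, a = s ∨ a = s + latticeShift L v := by
    rintro a (ha | ha)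
    · exact ⟨a, ha, Or.inl rfl⟩
    · exact ⟨_, ha, Or.inr (by simp)⟩
  have hSS' : Disjoint S S' := by
    refine Set.disjoint_left.2 fun z hz1 hz2 => hv0 ?_
    exact latticeShift_eq_zero_of_mem hL hz1.1 hz2.1 (by simp)
  have hvolA : volume A = 2 * volume S := by
    rw [hA, measure_union hSS' hS', hS'def, measure_preimage_add_right, two_mul]
  have hvolG : volume (G ⁻¹' A) = volume A := by
    have h1 := lintegral_abs_det_fderiv_eq_addHaar_image volume
      (hdiff.continuous.measurable hAm) (f := G) (f' := fderiv ℝ G)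
      (fun x _ => (hdiff x).hasFDerivAt.hasFDerivWithinAt) hleft.injective.injOn
    rw [Set.image_preimage_eq _ hright.surjective] at h1
    simpa [hdet] using h1
  have hsub : G ⁻¹' A ⊆ Phase.velBox d (U + c) := by
    intro z hz
    have h1 : (G z).velSup ≤ U := by
      obtain ⟨s, hs, h | h⟩ := hmemA _ hz
      · rw [h]; exact hs.2
      · rw [h, velSup_add_latticeShift]; exact hs.2
    have h2 := hc (G z)
    rw [hleft z] at h2
    have h3 : ‖((G z).vel - z.vel).ofLp‖ ≤ c := by
      rw [← neg_sub, WithLp.ofLp_neg, norm_neg]; exact h2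
    have := velSup_sub_le h3
    change z.velSup ≤ U + c
    linarith
  have hle := volume_le_of_disjoint_translates hL (hdiff.continuous.measurable hAm)
    (add_nonneg hU hc0) hsub (by
      intro a ha b hb m hab
      have h1 : G a = G b + latticeShift L (α m) := by rw [hab, hα]
      obtain ⟨s, hs, h⟩ := hmemA _ ha
      obtain ⟨s', hs', h'⟩ := hmemA _ hb
      rcases h with h | h <;> rcases h' with h' | h' <;> rw [h, h'] at h1
      · exact hαinj m (latticeShift_eq_zero_of_mem hL hs.1 hs'.1 h1)
      · rw [add_assoc, ← latticeShift_add] at h1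
        have := latticeShift_eq_zero_of_mem hL hs.1 hs'.1 h1
        refine absurd ?_ (hv (-m))
        rw [hαneg, neg_eq_iff_eq_neg]
        exact eq_neg_of_add_eq_zero_right this
      · have h2 : s = s' + latticeShift L (α m - v) := by
          rw [sub_eq_add_neg, latticeShift_add, latticeShift_neg, ← add_assoc, ← h1]; simp
        have := latticeShift_eq_zero_of_mem hL hs.1 hs'.1 h2
        exact absurd (sub_eq_zero.1 this) (hv m)
      · rw [add_right_comm] at h1
        exact hαinj m (latticeShift_eq_zero_of_mem hL hs.1 hs'.1 (add_right_cancel h1)))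
  rw [hvolG, hvolA, volume_boxCell hL hU, volume_boxCell hL (add_nonneg hU hc0),
    ← ENNReal.ofReal_ofNat, ← ENNReal.ofReal_mul (by norm_num),
    ENNReal.ofReal_le_ofReal_iff (by positivity)] at hle
  linarith

end TorusMaps

/-! ### Lattice compatibility of the exact flow. -/

section StochasticFlow

variable {Ω : Type*} [MeasurableSpace Ω] {P : Measure Ω} {L : ℝ} {T : ℝ≥0} {d K : ℕ}
  {E : ℝ → Vec d → Vec d} {σ : Fin K → Vec d → Vec d} {β : Fin K → ℝ≥0 → Ω → ℝ}
  {φ φinv : ℝ≥0 → Ω → Phase d → Phase d}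

theorem IsItoIntegral.ae_eq_zero {H B : ℝ≥0 → Ω → ℝ} {J : Ω → ℝ} (h : IsItoIntegral P H B 0 J) :
    J =ᵐ[P] 0 := by
  have h0 : TendstoInMeasure P (fun (m : ℕ) (ω : Ω) => ∑ i ∈ Finset.range m,
      H (i * 0 / m) ω * (B ((i + 1) * 0 / m) ω - B (i * 0 / m) ω)) atTop (0 : Ω → ℝ) := by
    have e : (fun (m : ℕ) (ω : Ω) => ∑ i ∈ Finset.range m,
        H (i * 0 / m) ω * (B ((i + 1) * 0 / m) ω - B (i * 0 / m) ω)) = fun _ => 0 := by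
      funext m ω
      simp
    rw [e]
    intro ε hε
    simp [hε.ne']
  exact tendstoInMeasure_ae_unique h h0

/-- At time zero the integrals in the equations vanish. Each equation has its own null set depending
on the starting point, so a countable dense set and continuity give a common one. -/
theorem IsStochasticFlow.ae_initial (hφ : IsStochasticFlow P L T E σ β φ φinv) :
    ∀ᵐ ω ∂P, φ 0 ω = id := by
  have hz : ∀ z, ∀ᵐ ω ∂P, φ 0 ω z = z := by
    intro z
    have h1 : ∀ᵐ ω ∂P, ∀ i, (φ 0 ω z).pos i = z.pos i := by
      rw [ae_all_iff]
      intro i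
      filter_upwards [hφ.position_eq 0 (zero_le) z i] with ω hω
      simpa using hω
    have h2 : ∀ᵐ ω ∂P, ∀ i, (φ 0 ω z).vel i = z.vel i := by
      rw [ae_all_iff]
      intro i
      obtain ⟨J, hJ, h⟩ := hφ.velocity_eq 0 (zero_le) z i
      have hJ0 : ∀ᵐ ω ∂P, ∀ k, J k ω = 0 := ae_all_iff.2 fun k => (hJ k).ae_eq_zero
      filter_upwards [h, hJ0] with ω hω hJω
      simpa [hJω] using hω
    filter_upwards [h1, h2] with ω hω1 hω2
    exact Phase.ext_iff_coord.2 ⟨hω1, hω2⟩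
  have hd : ∀ᵐ ω ∂P, ∀ n : ℕ, φ 0 ω (TopologicalSpace.denseSeq (Phase d) n)
      = TopologicalSpace.denseSeq (Phase d) n := ae_all_iff.2 fun n => hz _
  filter_upwards [hd, hφ.homeomorph] with ω hω hc
  refine DenseRange.equalizer (TopologicalSpace.denseRange_denseSeq (Phase d))
    (hc 0 (zero_le)).1 continuous_id ?_
  funext n
  exact hω n

/-- The lattice vector by which `φ_t(z + Lm)` and `φ_t(z)` differ is continuous in `t`, hence equal
to its value `Lm` at time zero. So `φ_T` commutes with lattice shifts, and so does its inverse. -/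
theorem IsStochasticFlow.ae_isTorusMap_inv (hL : 0 < L) (hφ : IsStochasticFlow P L T E σ β φ φinv) :
    ∀ᵐ ω ∂P, Phase.IsTorusMap L (φinv T ω) := by
  filter_upwards [hφ.ae_initial, hφ.torusMap, hφ.homeomorph, hφ.continuous_paths]
    with ω h0 htor hhom hpath
  have hshift : ∀ z m, φ T ω (z + latticeShift L m) = φ T ω z + latticeShift L m := by
    intro z m
    have hpc : ∀ z, Continuous fun t : Set.Iic T => φ t ω z := fun z =>
      continuousOn_iff_continuous_domRestrict.1 (hpath z)
    have : PreconnectedSpace (Set.Iic T) := Subtype.preconnectedSpace isPreconnected_Iic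
    have h := sub_eq_sub_of_continuous_of_latticeShift hL (hpc z) (hpc (z + latticeShift L m))
      (fun t => isTorusMap_iff.1 (htor t t.2) z m) ⟨T, Set.self_mem_Iic⟩ ⟨0, Set.mem_Iic.2 zero_le⟩
    simp only [h0, id, add_sub_cancel_left] at h
    exact sub_eq_iff_eq_add'.1 h
  obtain ⟨_, _, hl, hr⟩ := hhom T le_rfl
  rw [isTorusMap_iff]
  intro w m
  refine ⟨m, ?_⟩
  conv_lhs => rw [← hr w, ← hshift, hl]

end StochasticFlow

/-! ### Periodicity of the numerical solution. -/

section Periodicity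

variable {d : ℕ} {L : ℝ} {f₀ : Phase d → ℝ} {δ : Fin d ⊕ Fin d → ℝ} {ε₀ U₀ : ℝ} {ξ : ℕ → ℝ}
  {ψ : ℕ → Phase d → Phase d}

/-- Since `L` is a multiple of every position step, lattice shifts permute the grid points and
preserve the weights. -/
theorem interpolate_periodic (hδ : ∀ i, 0 < δ i) (hL : ∀ i : Fin d, ∃ m : ℕ, L = m * δ (Sum.inl i))
    {g : Phase d → ℝ} (hg : ∀ z m, g (z + latticeShift L m) = g z) (y : Phase d) (m : Fin d → ℤ) :
    interpolate δ g (y + latticeShift L m) = interpolate δ g y := by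
  choose M hM using hL
  set k : Fin d ⊕ Fin d → ℤ := Sum.elim (fun i => m i * M i) fun _ => 0 with hk
  have hshift : ∀ i, latticeShift L m i = k i * δ i := by
    rintro (i | i)
    · simp only [latticeShift_inl, hk, Sum.elim_inl]
      conv_lhs => rw [hM i]
      push_cast; ring
    · simp [hk]
  have hfl : ∀ i, ⌊(y + latticeShift L m) i / δ i⌋ = ⌊y i / δ i⌋ + k i := by
    intro i
    rw [PiLp.add_apply, hshift, add_div, mul_div_cancel_right₀ _ (hδ i).ne', Int.floor_add_intCast]
  rw [interpolate_eq_sum_offset, interpolate_eq_sum_offset]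
  refine Finset.sum_congr rfl fun s _ => ?_
  congr 1
  · rw [← hg (gridPoint δ fun i => ⌊y i / δ i⌋ + s i) m]
    congr 1
    ext i
    rw [PiLp.add_apply, hshift, gridPoint_apply, gridPoint_apply, hfl]
    push_cast; ring
  · refine Finset.prod_congr rfl fun i _ => ?_
    rw [hfl, PiLp.add_apply, hshift]
    simp only [lagrangeBasis, add_eq_left]
    push_cast
    split_ifs <;> ring

theorem semiLagrangianSolution_periodic (hδ : ∀ i, 0 < δ i)
    (hL : ∀ i : Fin d, ∃ m : ℕ, L = m * δ (Sum.inl i))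
    (hf : ∀ z m, f₀ (z + latticeShift L m) = f₀ z) {N : ℕ}
    (hψ : ∀ n < N, Phase.IsTorusMap L (ψ n)) (z : Phase d) (m : Fin d → ℤ) :
    semiLagrangianSolution f₀ δ ε₀ U₀ ξ ψ N (z + latticeShift L m)
      = semiLagrangianSolution f₀ δ ε₀ U₀ ξ ψ N z := by
  have hind : ∀ (U : ℝ) {g : Phase d → ℝ}, (∀ z m, g (z + latticeShift L m) = g z) →
      ∀ z m, (Phase.velBox d U).indicator g (z + latticeShift L m)
        = (Phase.velBox d U).indicator g z := by
    intro U g hg z m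
    have hiff : z + latticeShift L m ∈ Phase.velBox d U ↔ z ∈ Phase.velBox d U := by
      change (z + latticeShift L m).velSup ≤ U ↔ z.velSup ≤ U
      rw [velSup_add_latticeShift]
    by_cases h : z ∈ Phase.velBox d U
    · rw [Set.indicator_of_mem h, Set.indicator_of_mem (hiff.2 h), hg]
    · rw [Set.indicator_of_notMem h, Set.indicator_of_notMem (mt hiff.1 h)]
  induction N generalizing z m with
  | zero => exact hind U₀ hf z m
  | succ n ih =>
    have ih' := ih fun k hk => hψ k (by omega)
    refine hind _ (interpolate_periodic hδ hL (hind _ ?_)) z m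
    intro z m
    obtain ⟨k, hk⟩ := isTorusMap_iff.1 (hψ n (by omega)) z m
    change semiLagrangianSolution f₀ δ ε₀ U₀ ξ ψ n (ψ n (z + latticeShift L m)) = _
    rw [hk, ih']
    rfl

end Periodicity

/-! ### Mean-square estimates and the main theorem. -/

section Convergence

variable {Ω : Type*} {d K : ℕ} {L : ℝ} {T : ℝ≥0}
  {E : ℝ → Vec d → Vec d} {σ : Fin K → Vec d → Vec d} {β : Fin K → ℝ≥0 → Ω → ℝ}
  {f₀ : Phase d → ℝ} {N : ℕ} {Ψ Ψinv : ℕ → Ω → Phase d → Phase d}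

theorem gridTime_mono (T : ℝ≥0) (N : ℕ) : Monotone (gridTime T N) := by
  intro m n h
  unfold gridTime
  gcongr

theorem gridTime_self (T : ℝ≥0) (hN : 1 ≤ N) : gridTime T N N = T := by
  unfold gridTime
  have : (N : ℝ≥0) ≠ 0 := by positivity
  field_simp

theorem contDiff_composedInverseFlow {ψ : ℕ → Phase d → Phase d} {n : ℕ}
    (hc : ∀ k < n, ContDiff ℝ 2 (ψ k)) : ContDiff ℝ 2 (composedInverseFlow ψ n) := by
  induction n with
  | zero => exact contDiff_id
  | succ n ih => exact (ih fun k hk => hc k (by omega)).comp (hc n (by omega))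

theorem IsVolumePreservingIntegrator.measurable_of_le
    (hΨ : IsVolumePreservingIntegrator L T E σ β N Ψ Ψinv) {n : ℕ} (hn : n ≤ N) :
    ∀ k < n, ∀ z, Measurable[incrementAlgebra β 0 (gridTime T N n)] fun ω => Ψinv k ω z :=
  fun k hk z => (hΨ.adapted k (by omega) z).mono
    (incrementAlgebra_mono zero_le (gridTime_mono T N hk)) le_rfl

variable [mΩ : MeasurableSpace Ω] {P : Measure Ω}

theorem eLpNorm_errorMajorant_le [IsProbabilityMeasure P] (hβ : IsStandardBrownian P β)
    (hΨ : IsVolumePreservingIntegrator L T E σ β N Ψ Ψinv) {A : ℝ → ℝ≥0}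
    (hA : IsStableFlow P N Ψ Ψinv A) {c₁ c₂ : ℝ} (hf : ContDiff ℝ 2 f₀)
    (h1 : ∀ z, ‖fderiv ℝ f₀ z‖ ≤ c₁) (h2 : ∀ z, ‖iteratedFDeriv ℝ 2 f₀ z‖ ≤ c₂)
    {δ : Fin d ⊕ Fin d → ℝ} (hδ : ∀ i, 0 < δ i) {ε₀ κ : ℝ} (hε : 0 ≤ ε₀) (hκ : 0 ≤ κ) {n : ℕ}
    (hn : n ≤ N) (y : Phase d) :
    eLpNorm (fun ω => errorMajorant f₀ δ ε₀ κ (fun k => Ψinv k ω) n y) 2 P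
      ≤ ENNReal.ofReal (ε₀ + n * (√(2 * c₂ ^ 2 * A 4 + 2 * c₁ ^ 2 * A 2) * (2 * d * ‖δ‖ ^ 2)
        + (ε₀ + κ))) := by
  set M := √(2 * c₂ ^ 2 * A 4 + 2 * c₁ ^ 2 * A 2) * (2 * d * ‖δ‖ ^ 2) with hM
  have hM0 : 0 ≤ M := by positivity
  induction n generalizing y with
  | zero =>
    have e : (fun ω => errorMajorant f₀ δ ε₀ κ (fun k => Ψinv k ω) 0 y) = fun _ => ε₀ := rfl
    rw [e, eLpNorm_const' _ (by simp) (by simp)]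
    simp [← ofReal_norm, abs_of_nonneg hε]
  | succ n ih =>
    have ih' := ih (by omega)
    have hle : ∀ r t, incrementAlgebra β r t ≤ mΩ := incrementAlgebra_le hβ.measurable
    have hcont : ∀ k < N, ∀ ω, Continuous (Ψinv k ω) := fun k hk ω =>
      (hΨ.contDiff_inv k hk ω).continuous
    have hmeas : ∀ k < N, ∀ z, Measurable fun ω => Ψinv k ω z := fun k hk z =>
      (hΨ.adapted k hk z).mono (hle _ _) le_rfl
    set a : Ω → Phase d → ℝ := fun ω => errorMajorant f₀ δ ε₀ κ (fun k => Ψinv k ω) n with ha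
    have ham : Measurable fun p : Ω × Phase d => a p.1 p.2 :=
      measurable_errorMajorant hf.continuous δ ε₀ κ (fun k hk => hcont k (by omega))
        (fun k hk => hmeas k (by omega))
    -- Joint measurability with respect to the past alone; this is where a majorant free of `Ξ` is
    -- needed.
    have ham' : @Measurable (Ω × Phase d) ℝ
        ((incrementAlgebra β 0 (gridTime T N n)).prod inferInstance) _ fun p => a p.1 p.2 :=
      @measurable_errorMajorant Ω (incrementAlgebra β 0 (gridTime T N n)) d f₀ hf.continuous δ ε₀ κ
        Ψinv n (fun k hk => hcont k (by omega)) (hΨ.measurable_of_le (by omega))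
    set C : ℝ := ε₀ + n * (M + (ε₀ + κ)) with hC
    have hC0 : 0 ≤ C := by positivity
    -- The random foot can be frozen because it is independent of `a_n`; the induction hypothesis is
    -- uniform in the frozen point.
    have hfreeze : ∀ z, eLpNorm (fun ω => a ω (Ψinv n ω z)) 2 P ≤ ENNReal.ofReal C := fun z =>
      eLpNorm_comp_le_of_indep (hle _ _) (hle _ _)
        (indep_incrementAlgebra hβ (gridTime T N n) (gridTime T N (n + 1))) ham'
        (hΨ.adapted n (by omega) z) ih'
    have hmz : ∀ z, Measurable fun ω => a ω (Ψinv n ω z) := fun z =>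
      ham.comp (measurable_id.prodMk (hmeas n (by omega) z))
    set Φ : Ω → Phase d → Phase d := fun ω => composedInverseFlow (fun k => Ψinv k ω) (n + 1) with hΦ
    have hΦj : Measurable fun p : Ω × Phase d => Φ p.1 p.2 :=
      measurable_composedInverseFlow (fun k hk => hcont k (by omega))
        (fun k hk => hmeas k (by omega))
    have hΦm : ∀ z, Measurable fun ω => Φ ω z := fun z =>
      hΦj.comp (measurable_id.prodMk measurable_const)
    have hΦc : ∀ ω, ContDiff ℝ 2 (Φ ω) := fun ω =>
      contDiff_composedInverseFlow fun k hk => hΨ.contDiff_inv k (by omega) ω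
    have hres := eLpNorm_interpolation_error_le (P := P) hδ hΦc hΦm
      (fun z => le_add_self.trans (hA 1 (by simp) 4 (by norm_num) (n + 1) hn z))
      (fun z => le_add_self.trans (hA 2 (by simp) 2 le_rfl (n + 1) hn z)) hf h1 h2 y
    have hresm : Measurable fun ω => interpolate δ (f₀ ∘ Φ ω) y - (f₀ ∘ Φ ω) y := by
      have h3 : ∀ z, Measurable fun ω => (f₀ ∘ Φ ω) z := fun z =>
        hf.continuous.measurable.comp (hΦm z)
      exact ((measurable_interpolate δ h3).comp (measurable_id.prodMk measurable_const)).sub (h3 y)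
    set I : Ω → ℝ := ∑ l ∈ cellVertices δ y,
      vertexWeight δ y l • fun ω => a ω (Ψinv n ω (gridPoint δ l)) with hI
    have hIm : Measurable I := by
      have e : I = fun ω => ∑ l ∈ cellVertices δ y,
          (vertexWeight δ y l • fun ω => a ω (Ψinv n ω (gridPoint δ l))) ω := by
        funext ω
        rw [hI, Finset.sum_apply]
      rw [e]
      exact Finset.measurable_sum _ fun l _ =>
        (hmz (gridPoint δ l)).const_smul (vertexWeight δ y l)
    have hInorm : eLpNorm I 2 P ≤ ENNReal.ofReal C := by
      refine (eLpNorm_sum_le (fun l _ => ((hmz _).const_smul _).aestronglyMeasurable)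
        (by norm_num)).trans ?_
      calc ∑ l ∈ cellVertices δ y,
            eLpNorm (vertexWeight δ y l • fun ω => a ω (Ψinv n ω (gridPoint δ l))) 2 P
          ≤ ∑ l ∈ cellVertices δ y, ENNReal.ofReal (vertexWeight δ y l) * ENNReal.ofReal C := by
            refine Finset.sum_le_sum fun l hl => ?_
            rw [eLpNorm_const_smul, ← ofReal_norm, Real.norm_eq_abs,
              abs_of_nonneg (vertexWeight_nonneg hδ)]
            gcongr
            exact hfreeze _
        _ = ENNReal.ofReal C := by
            rw [← Finset.sum_mul, ← ENNReal.ofReal_sum_of_nonneg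
              (fun l _ => vertexWeight_nonneg hδ), sum_vertexWeight hδ, ENNReal.ofReal_one, one_mul]
    have e : (fun ω => errorMajorant f₀ δ ε₀ κ (fun k => Ψinv k ω) (n + 1) y)
        = (I + fun ω => |interpolate δ (f₀ ∘ Φ ω) y - (f₀ ∘ Φ ω) y|) + fun _ => ε₀ + κ := by
      funext ω
      simp only [errorMajorant, Pi.add_apply, hI, Finset.sum_apply, Pi.smul_apply, smul_eq_mul,
        interpolate_eq, Function.comp_apply]
      congr 2
      exact Finset.sum_congr rfl fun l _ => mul_comm _ _
    rw [e]
    calc eLpNorm ((I + fun ω => |interpolate δ (f₀ ∘ Φ ω) y - (f₀ ∘ Φ ω) y|) + fun _ => ε₀ + κ) 2 P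
        ≤ eLpNorm I 2 P + eLpNorm (fun ω => |interpolate δ (f₀ ∘ Φ ω) y - (f₀ ∘ Φ ω) y|) 2 P
          + eLpNorm (fun _ : Ω => ε₀ + κ) 2 P := by
          refine (eLpNorm_add_le (hIm.add hresm.abs).aestronglyMeasurable
            aestronglyMeasurable_const (by norm_num)).trans ?_
          gcongr
          exact eLpNorm_add_le hIm.aestronglyMeasurable hresm.abs.aestronglyMeasurable (by norm_num)
      _ ≤ ENNReal.ofReal C + ENNReal.ofReal M + ENNReal.ofReal (ε₀ + κ) := by
          gcongr
          · refine le_trans (le_of_eq ?_) hres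
            exact eLpNorm_norm (fun ω => interpolate δ (f₀ ∘ Φ ω) y - (f₀ ∘ Φ ω) y)
          · rw [eLpNorm_const' _ (by simp) (by simp)]
            simp [← ofReal_norm, abs_of_nonneg (add_nonneg hε hκ)]
      _ = ENNReal.ofReal (ε₀ + ((n + 1 : ℕ) : ℝ) * (M + (ε₀ + κ))) := by
          rw [← ENNReal.ofReal_add hC0 hM0, ← ENNReal.ofReal_add (by positivity) (by positivity), hC]
          congr 1
          push_cast; ring

theorem abs_sub_le_torusDist (hper : ∀ z m, f₀ (z + latticeShift L m) = f₀ z)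
    {c : ℝ≥0} (hc : LipschitzWith c f₀) (z w : Phase d) :
    |f₀ z - f₀ w| ≤ c * Phase.torusDist L z w := by
  -- Rounding selects the lattice translate of `w` nearest to `z`, at which the Euclidean distance
  -- equals the torus distance.
  set m : Fin d → ℤ := fun i => round (L⁻¹ * (z (Sum.inl i) - w (Sum.inl i))) with hm
  rw [← hper w m, ← Real.dist_eq]
  refine (hc.dist_le_mul _ _).trans (le_of_eq ?_)
  rw [EuclideanSpace.dist_eq, Fintype.sum_sum_type]
  unfold Phase.torusDist
  congr 3
  · refine Finset.sum_congr rfl fun i _ => ?_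
    rw [AddCircle.norm_eq, Real.dist_eq, PiLp.add_apply, latticeShift_inl, sub_add_eq_sub_sub]
  · refine Finset.sum_congr rfl fun i _ => ?_
    rw [Real.dist_eq, sq_abs, PiLp.add_apply, latticeShift_inr, add_zero]

theorem eLpNorm_comp_sub_le [IsProbabilityMeasure P]
    (hper : ∀ z m, f₀ (z + latticeShift L m) = f₀ z) {c : ℝ≥0} (hc : LipschitzWith c f₀)
    {X Y : Ω → Phase d} (hX : AEStronglyMeasurable X P) (hY : AEStronglyMeasurable Y P)
    {p₀ : ℝ} (hp₀ : 1 ≤ p₀) {D : ℝ≥0∞}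
    (hD : (∫⁻ ω, ENNReal.ofReal (Phase.torusDist L (X ω) (Y ω)) ^ (2 * p₀) ∂P) ^ (1 / (2 * p₀)) ≤ D) :
    eLpNorm (fun ω => f₀ (X ω) - f₀ (Y ω)) 2 P ≤ c * D := by
  have hpos : 0 < 2 * p₀ := by linarith
  have hm : AEStronglyMeasurable (fun ω => f₀ (X ω) - f₀ (Y ω)) P :=
    (hc.continuous.comp_aestronglyMeasurable hX).sub (hc.continuous.comp_aestronglyMeasurable hY)
  have h2 : (2 : ℝ≥0∞) ≤ ENNReal.ofReal (2 * p₀) := by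
    rw [← ENNReal.ofReal_ofNat]
    exact ENNReal.ofReal_le_ofReal (by linarith)
  refine (eLpNorm_le_eLpNorm_of_exponent_le h2 hm).trans ?_
  rw [eLpNorm_eq_lintegral_rpow_enorm_toReal (ENNReal.ofReal_pos.2 hpos).ne' ENNReal.ofReal_ne_top,
    ENNReal.toReal_ofReal hpos.le]
  calc (∫⁻ ω, ‖f₀ (X ω) - f₀ (Y ω)‖ₑ ^ (2 * p₀) ∂P) ^ (1 / (2 * p₀))
      ≤ (∫⁻ ω, (c : ℝ≥0∞) ^ (2 * p₀)
        * ENNReal.ofReal (Phase.torusDist L (X ω) (Y ω)) ^ (2 * p₀) ∂P) ^ (1 / (2 * p₀)) := by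
        gcongr with ω
        rw [← ENNReal.mul_rpow_of_nonneg _ _ hpos.le]
        gcongr
        rw [← ofReal_norm, ← ENNReal.ofReal_coe_nnreal, ← ENNReal.ofReal_mul c.coe_nonneg]
        exact ENNReal.ofReal_le_ofReal (abs_sub_le_torusDist hper hc _ _)
    _ = c * (∫⁻ ω, ENNReal.ofReal (Phase.torusDist L (X ω) (Y ω)) ^ (2 * p₀) ∂P)
        ^ (1 / (2 * p₀)) := by
        rw [lintegral_const_mul' _ _ (ENNReal.rpow_ne_top_of_nonneg hpos.le ENNReal.coe_ne_top),
          ENNReal.mul_rpow_of_nonneg _ _ (by positivity), ← ENNReal.rpow_mul,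
          mul_one_div_cancel hpos.ne', ENNReal.rpow_one]
    _ ≤ c * D := by gcongr

theorem norm_toLp_le {v : Fin d → ℝ} {r : ℝ} (hr : 0 ≤ r) (h : ∀ i, |v i| ≤ r) :
    ‖(WithLp.toLp 2 v : Vec d)‖ ≤ √d * r := by
  rw [EuclideanSpace.norm_eq, ← Real.sqrt_sq hr, ← Real.sqrt_mul (by positivity)]
  refine Real.sqrt_le_sqrt ?_
  calc ∑ i, ‖v i‖ ^ 2 ≤ ∑ _i : Fin d, r ^ 2 := by
        refine Finset.sum_le_sum fun i _ => ?_
        exact pow_le_pow_left₀ (norm_nonneg _) (h i) 2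
    _ = d * r ^ 2 := by simp

/-- On the fundamental cell the position has norm at most `√d L`, so only the velocity range
contributes growth. -/
theorem growth_le (hL : 0 < L) {γ : ℝ} (hγ : 0 ≤ γ) {R : ℝ} {z : Phase d}
    (hz : z ∈ Phase.fundamentalCell d L) (hR : z ∈ Phase.velBox d R) :
    (1 + ‖z.pos‖ ^ (2 * γ) + ‖z.vel‖ ^ (2 * γ)) ^ (1 / 2 : ℝ)
      ≤ (1 + 2 * (√d * max L 1) ^ (2 * γ)) ^ (1 / 2 : ℝ) * (max R 1) ^ γ := by
  set ρ := max R 1 with hρ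
  have hρ1 : 1 ≤ ρ := le_max_right _ _
  have hρ0 : 0 ≤ ρ := by linarith
  set b := √d * max L 1 with hb
  have hl1 : 1 ≤ max L 1 := le_max_right _ _
  have hb0 : 0 ≤ b := by positivity
  have hpos : ‖z.pos‖ ≤ b * ρ := by
    refine (norm_toLp_le hL.le fun i => ?_).trans ?_
    · have := hz i
      rw [abs_of_nonneg this.1]
      exact this.2.le
    · rw [hb, mul_assoc]
      gcongr
      nlinarith [le_max_left L 1]
  have hvel : ‖z.vel‖ ≤ b * ρ := by
    refine (norm_toLp_le hρ0 fun i => ?_).trans ?_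
    · exact ((z.abs_le_velSup i).trans hR).trans (le_max_left _ _)
    · rw [hb, mul_assoc]
      gcongr
      nlinarith
  have h2γ : 0 ≤ 2 * γ := by linarith
  have key : 1 + ‖z.pos‖ ^ (2 * γ) + ‖z.vel‖ ^ (2 * γ) ≤ (1 + 2 * b ^ (2 * γ)) * ρ ^ (2 * γ) := by
    have e1 := Real.rpow_le_rpow (norm_nonneg _) hpos h2γ
    have e2 := Real.rpow_le_rpow (norm_nonneg _) hvel h2γ
    rw [Real.mul_rpow hb0 hρ0] at e1 e2
    have e3 := Real.one_le_rpow hρ1 h2γ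
    linarith
  calc (1 + ‖z.pos‖ ^ (2 * γ) + ‖z.vel‖ ^ (2 * γ)) ^ (1 / 2 : ℝ)
      ≤ ((1 + 2 * b ^ (2 * γ)) * ρ ^ (2 * γ)) ^ (1 / 2 : ℝ) :=
        Real.rpow_le_rpow (by positivity) key (by norm_num)
    _ = (1 + 2 * b ^ (2 * γ)) ^ (1 / 2 : ℝ) * ρ ^ γ := by
        rw [Real.mul_rpow (by positivity) (by positivity), ← Real.rpow_mul hρ0]
        congr 2
        ring

end Convergence

theorem theorem4p1 {Ω : Type*} [MeasurableSpace Ω] (P : Measure Ω) [IsProbabilityMeasure P]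
    (d K : ℕ) (hd : 1 ≤ d) (hK : 1 ≤ K) (L : ℝ) (hL : 0 < L) (T : ℝ≥0) (hT : 0 < T)
    (E : ℝ → Vec d → Vec d) (σ : Fin K → Vec d → Vec d) (hEσ : IsLipschitzData L T E σ)
    (f₀ : Phase d → ℝ) (hf₀ : IsInitialDensity L f₀)
    (β : Fin K → ℝ≥0 → Ω → ℝ) (hβ : IsStandardBrownian P β)
    (φ φinv : ℝ≥0 → Ω → Phase d → Phase d) (hφ : IsStochasticFlow P L T E σ β φ φinv)
    (A : ℝ → ℝ≥0) (B : ℝ≥0) (Q γ p₀ : ℝ) (hQ : 0 < Q) (hγ : 1 ≤ γ) (hp₀ : 1 ≤ p₀) :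
    ∃ C : ℝ, 0 < C ∧
      ∀ N : ℕ, 1 ≤ N → ∀ Ψ Ψinv : ℕ → Ω → Phase d → Phase d,
        IsVolumePreservingIntegrator L T E σ β N Ψ Ψinv →
        IsStableFlow P N Ψ Ψinv A →
        IsConvergentFlow P L T N Ψinv φinv Q γ p₀ B →
        ∀ (δ : Fin d ⊕ Fin d → ℝ) (ε₀ U₀ : ℝ) (Ξ : ℕ → Ω → ℝ),
          IsAdmissible L T E σ β f₀ N δ ε₀ U₀ Ξ →
          ∀ R : ℝ, 0 < R → ∀ z ∈ Phase.velBox d R,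
            (∫⁻ ω, ‖semiLagrangianSolution f₀ δ ε₀ U₀ (fun n => Ξ n ω) (fun n => Ψinv n ω) N z
                - vlasovSolution f₀ φinv T ω z‖ₑ ^ 2 ∂P) ^ (1 / 2 : ℝ)
              ≤ ENNReal.ofReal (C * (max R 1) ^ γ * ((T : ℝ) / N) ^ Q
                  + C * ((T : ℝ) / N)⁻¹ * (‖δ‖ ^ 2 + ε₀)) := by
  obtain ⟨c₁, hc₁⟩ := hf₀.lipschitz
  obtain ⟨c₂, hc₂⟩ := hf₀.bounded_second
  have hc₂0 : 0 ≤ c₂ := (norm_nonneg _).trans (hc₂ 0)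
  have hfd : ∀ z, ‖fderiv ℝ f₀ z‖ ≤ c₁ := fun z => norm_fderiv_le_of_lipschitz ℝ hc₁
  have hper : ∀ z m, f₀ (z + latticeShift L m) = f₀ z := fun z m =>
    hf₀.periodic _ _ (latticeEquiv_iff.2 ⟨m, rfl⟩)
  set S := √(2 * c₂ ^ 2 * A 4 + 2 * (c₁ : ℝ) ^ 2 * A 2) with hS
  set C₁ : ℝ := c₁ * (B * (1 + 2 * (√d * max L 1) ^ (2 * γ)) ^ (1 / 2 : ℝ)) with hC₁
  -- `T` comes from `N = T/τ`, the `2` from `ε₀ + N ε₀ ≤ 2N ε₀`, and `S`, `c₂` from the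
  -- interpolation errors of `f_{n+1}` and of `f₀`.
  set C₂ : ℝ := T * (2 + (S + c₂) * (2 * d)) with hC₂
  have hC₁0 : 0 ≤ C₁ := by positivity
  have hC₂0 : 0 ≤ C₂ := by positivity
  refine ⟨1 + C₁ + C₂, by positivity, ?_⟩
  intro N hN Ψ Ψinv hΨ hA hconv δ ε₀ U₀ Ξ hadm R hR z₀ hz₀
  have hδ := hadm.step_pos
  have hε := hadm.threshold_pos
  have htor : ∀ ω, ∀ n < N, Phase.IsTorusMap L (Ψinv n ω) := fun ω n hn =>
    (hΨ.torusMap n hn ω).inverse hL (hΨ.leftInverse n hn ω) (hΨ.rightInverse n hn ω)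
      ((hΨ.contDiff n hn ω).differentiable (by norm_num)) (hΨ.volume_preserving n hn ω)
      (hΨ.velocity_step n hn ω)
  -- Replace the point by its representative in the fundamental cell; otherwise the convergence
  -- hypothesis would contribute an unbounded `‖x‖`.
  obtain ⟨m, hm⟩ := exists_sub_latticeShift_mem hL z₀
  set z := z₀ - latticeShift L m with hz
  have hz₀' : z₀ = z + latticeShift L m := by simp [hz]
  have hzR : z ∈ Phase.velBox d R := by
    change z.velSup ≤ R
    rw [← velSup_add_latticeShift (L := L) z m, ← hz₀']
    exact hz₀
  set κ : ℝ := c₂ * (2 * d * ‖δ‖ ^ 2) with hκ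
  have hκ0 : 0 ≤ κ := by positivity
  set a : Ω → ℝ := fun ω => errorMajorant f₀ δ ε₀ κ (fun k => Ψinv k ω) N z with ha
  set X : Ω → Phase d := fun ω => composedInverseFlow (fun k => Ψinv k ω) N z with hX
  set Y : Ω → Phase d := fun ω => φinv T ω z with hY
  have hcont : ∀ k < N, ∀ ω, Continuous (Ψinv k ω) := fun k hk ω =>
    (hΨ.contDiff_inv k hk ω).continuous
  have hmeas : ∀ k < N, ∀ z, Measurable fun ω => Ψinv k ω z := fun k hk z =>
    (hΨ.adapted k hk z).mono (incrementAlgebra_le hβ.measurable _ _) le_rfl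
  have ham : Measurable a :=
    (measurable_errorMajorant hf₀.contDiff.continuous δ ε₀ κ hcont hmeas).comp
      (measurable_id.prodMk measurable_const)
  have hXm : AEStronglyMeasurable X P :=
    ((measurable_composedInverseFlow hcont hmeas).comp
      (measurable_id.prodMk measurable_const)).aestronglyMeasurable
  have hYm : AEStronglyMeasurable Y P :=
    (hφ.adapted_inv T le_rfl z).mono (incrementAlgebra_le hβ.measurable _ _)
  have hfm : AEStronglyMeasurable (fun ω => f₀ (X ω) - f₀ (Y ω)) P :=
    (hc₁.continuous.comp_aestronglyMeasurable hXm).sub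
      (hc₁.continuous.comp_aestronglyMeasurable hYm)
  -- pathwise comparison
  have hpath : ∀ᵐ ω ∂P, ‖semiLagrangianSolution f₀ δ ε₀ U₀ (fun n => Ξ n ω) (fun n => Ψinv n ω) N z₀
      - vlasovSolution f₀ φinv T ω z₀‖ ≤ ‖(a + fun ω => ‖f₀ (X ω) - f₀ (Y ω)‖) ω‖ := by
    filter_upwards [hφ.ae_isTorusMap_inv hL] with ω hω
    have e1 : semiLagrangianSolution f₀ δ ε₀ U₀ (fun n => Ξ n ω) (fun n => Ψinv n ω) N z₀
        = semiLagrangianSolution f₀ δ ε₀ U₀ (fun n => Ξ n ω) (fun n => Ψinv n ω) N z := by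
      rw [hz₀']
      exact semiLagrangianSolution_periodic hδ hadm.L_multiple hper (htor ω) z m
    have e2 : vlasovSolution f₀ φinv T ω z₀ = f₀ (Y ω) := by
      obtain ⟨k, hk⟩ := isTorusMap_iff.1 hω z m
      rw [hz₀']
      unfold vlasovSolution
      rw [hk, hper]
    have e3 := abs_semiLagrangianSolution_sub_le hd hf₀.contDiff.continuous hδ hε hadm.U₀_pos
      hadm.below_threshold (abs_interpolation_error_le hδ hf₀.contDiff hc₂)
      (ψ := fun n => Ψinv n ω) (ξ := fun n => Ξ n ω)
      (fun n hn z => (hΨ.velocity_step n hn ω z).trans (hadm.dominates n hn ω))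
      hadm.U₀_multiple (fun n hn i => hadm.Ξ_multiple n hn ω i) z
    rw [e1, e2]
    simp only [Real.norm_eq_abs]
    refine le_trans ?_ (le_abs_self _)
    exact (abs_sub_le _ (f₀ (X ω)) _).trans (add_le_add e3 le_rfl)
  have hmaj := eLpNorm_errorMajorant_le hβ hΨ hA hf₀.contDiff hfd hc₂ hδ hε.le hκ0 le_rfl z
  have hcmp := eLpNorm_comp_sub_le hper hc₁ hXm hYm hp₀
    (by simpa only [gridTime_self T hN] using hconv N le_rfl z)
  set τ : ℝ := (T : ℝ) / N with hτ
  have hT' : (0 : ℝ) < T := hT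
  have hN' : (1 : ℝ) ≤ N := by exact_mod_cast hN
  have hτ0 : 0 < τ := by positivity
  have hNτ : (N : ℝ) = T * τ⁻¹ := by rw [hτ]; field_simp
  rw [← eLpNorm_two_eq]
  calc _ ≤ eLpNorm (a + fun ω => ‖f₀ (X ω) - f₀ (Y ω)‖) 2 P := eLpNorm_mono_ae hpath
    _ ≤ eLpNorm a 2 P + eLpNorm (fun ω => f₀ (X ω) - f₀ (Y ω)) 2 P := by
        rw [← eLpNorm_norm (fun ω => f₀ (X ω) - f₀ (Y ω))]
        exact eLpNorm_add_le ham.aestronglyMeasurable hfm.norm (by norm_num)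
    _ ≤ _ := add_le_add hmaj hcmp
    _ = ENNReal.ofReal ((ε₀ + N * (S * (2 * d * ‖δ‖ ^ 2) + (ε₀ + κ)))
        + c₁ * (B * τ ^ Q * (1 + ‖z.pos‖ ^ (2 * γ) + ‖z.vel‖ ^ (2 * γ)) ^ (1 / 2 : ℝ))) := by
        symm
        rw [ENNReal.ofReal_add (by positivity) (by positivity), ENNReal.ofReal_mul (p := (c₁ : ℝ)) c₁.coe_nonneg,
          ENNReal.ofReal_coe_nnreal]
    _ ≤ ENNReal.ofReal ((1 + C₁ + C₂) * (max R 1) ^ γ * τ ^ Q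
        + (1 + C₁ + C₂) * τ⁻¹ * (‖δ‖ ^ 2 + ε₀)) := by
        refine ENNReal.ofReal_le_ofReal ?_
        rw [add_comm]
        refine add_le_add ?_ ?_
        · have hg := growth_le hL (by linarith : 0 ≤ γ) hm hzR
          calc c₁ * (B * τ ^ Q * (1 + ‖z.pos‖ ^ (2 * γ) + ‖z.vel‖ ^ (2 * γ)) ^ (1 / 2 : ℝ))
              ≤ c₁ * (B * τ ^ Q * ((1 + 2 * (√d * max L 1) ^ (2 * γ)) ^ (1 / 2 : ℝ)
                * (max R 1) ^ γ)) := by gcongr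
            _ = C₁ * (max R 1) ^ γ * τ ^ Q := by rw [hC₁]; ring
            _ ≤ _ := by
                have : (0 : ℝ) ≤ max R 1 := le_trans zero_le_one (le_max_right _ _)
                gcongr
                linarith
        · calc ε₀ + N * (S * (2 * d * ‖δ‖ ^ 2) + (ε₀ + κ))
              ≤ N * (2 * ε₀ + (S + c₂) * (2 * d) * ‖δ‖ ^ 2) := by rw [hκ]; nlinarith
            _ ≤ N * ((2 + (S + c₂) * (2 * d)) * (‖δ‖ ^ 2 + ε₀)) := by
                have : 0 ≤ (S + c₂) * (2 * d) := by positivity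
                gcongr
                nlinarith [sq_nonneg ‖δ‖]
            _ = C₂ * τ⁻¹ * (‖δ‖ ^ 2 + ε₀) := by rw [hNτ, hC₂]; ring
            _ ≤ _ := by
                gcongr
                linarith
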